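/- Let $n\geq 2$ and let $\Omega_n=\{1<2<\cdots<n\}$. Partial transformations of $\Omega_n$ are composed from left to right. Let $\mathcal{PIO}_n$ (respectively $\mathcal{PIM}_n$) be the monoid of all order-preserving (respectively order-preserving or order-reversing) partial transformations of $\Omega_n$ whose domain and image are both intervals of $\Omega_n$ (the empty set is an interval). For $1\leq i\leq n-1$ let $$a_i=\begin{pmatrix}1&\cdots&i&i+1&\cdots&n\\1&\cdots&i&i&\cdots&n-1\end{pmatrix},\qquad b_i=\begin{pmatrix}1&\cdots&i&i+1&\cdots&n\\2&\cdots&i+1&i+1&\cdots&n\end{pmatrix},$$ let $e_i$ be the identity map on $\{1,\dots,i\}$, $f_{i+1}$ the identity map on $\{i+1,\dots,n\}$, and let $h$ be the permutation $x\mapsto n+1-x$. Put $X=\{a_i,b_i,e_i,f_{i+1}\mid 1\leq i\leq n-1\}$ and $D=X\cup\{h\}$, used both as sets of transformations and as alphabets. A monoid $M$ is defined by a presentation $\langle A\mid R\rangle$ on generators $A\subseteq M$ if there is an isomorphism from $A^*/{\sim_R}$ onto $M$ that sends the class of each letter to the generator it denotes, where $\sim_R$ is the congruence on $A^*$ generated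 by $R$. For a set $R'$ of relations over $X$, let $\widehat R$ be $R'$ together with the relations $$(N_0)\ h^2=1,\qquad (N_1)\ ha_i=b_{n-i}h,\qquad (N_1')\ he_i=f_{n-i+1}h\quad(1\leq i\leq n-1),\qquad (N_2)\ a_1^{n-1}h=b_{n-1}^{n-1}.$$ **Theorem.** The alphabet $D$ has $4n-3$ letters, and they denote pairwise distinct transformations. If $\langle X\mid R'\rangle$ is any presentation that defines $\mathcal{PIO}_n$ on the generators $X$, then $\mathcal{PIM}_n$ is defined by $\langle D\mid\widehat R\rangle$, and $|\widehat R|=|R'|+2n$. Moreover, $\mathcal{PIO}_n$ is defined by a presentation $\langle X\mid R'\rangle$ with exactly $5n^2+3n-10$ relations, for which, therefore, $\langle D\mid\widehat R\rangle$ is a presentation of $\mathcal{PIM}_n$ on $4n-3$ generators with exactly $5n^2+5n-10$ relations; for example, one can take for $R'$ the following relations (in which $1\leq i\leq n-1$ unless another range is given): 1. $a_ia_j=a_{j+1}a_i$ and $a_ib_j=b_{j+1}a_{i+1}$ and $a_ie_j=e_{j+1}a_i$ for $1\leq i\leq j\leq n-2$; 2. $b_ib_j=b_{j-1}b_i$ and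 $b_ie_j=e_{j-1}b_i$ for $2\leq j\leq i\leq n-1$; 3. $a_if_j=f_{j+1}a_i$ for $1\leq i<j\leq n-1$, and $b_if_j=f_{j-1}b_i$ for $3\leq j\leq i+1\leq n$; 4. $a_ia_{n-1}=a_i$, $\ b_ib_1=b_i$, $\ a_ib_{n-1}=b_i$, $\ b_ia_1=a_i$, $\ a_ie_{n-1}=a_i$, $\ b_if_2=b_i$, $\ e_ia_i=e_i$, $\ f_{i+1}b_i=f_{i+1}$; 5. $e_ie_j=e_i$ for $1\leq i\leq j\leq n-1$, and $f_jf_i=f_j$ for $2\leq i\leq j\leq n$; 6. $e_{i+1}e_i=e_i$, $\ f_{i+1}f_{i+2}=f_{i+2}$, $\ a_{i+1}e_i=e_i$, $\ b_if_{i+2}=f_{i+2}$ for $1\leq i\leq n-2$; 7. $f_je_i=e_if_j$ for $2\leq j\leq i+1\leq n$; 8. $a_if_n=f_ne_1$, $\ b_ie_1=f_ne_1$, $\ e_if_{i+1}=a_if_n$; 9. $a_1f_ne_1=f_ne_1$, $\ b_{n-1}f_ne_1=f_ne_1$. -/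

import Mathlib

/-! Partial transformations of a finite chain, composed from left to right. -/

/-- The chain `1 < 2 < ⋯ < n`. -/
abbrev Chain (n : ℕ) : Type := {x : ℕ // 1 ≤ x ∧ x ≤ n}

/-- Partial transformations of the chain; `α x = none` means that `x` is not in the domain. -/
abbrev PT (n : ℕ) : Type := Chain n → Option (Chain n)

namespace PT

variable {n : ℕ}

/-- The product `α * β` is "first `α`, then `β`". -/
instance : Monoid (PT n) where
  one := fun x => some x
  mul α β := fun x => (α x).bind β
  one_mul _ := rfl
  mul_one α := by
    funext x
    change (α x).bind some = α x
    simp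
  mul_assoc α β γ := by
    funext x
    change ((α x).bind β).bind γ = (α x).bind fun y => (β y).bind γ
    exact Option.bind_assoc (α x) β γ

theorem one_apply (x : Chain n) : (1 : PT n) x = some x := rfl

theorem mul_apply (α β : PT n) (x : Chain n) : (α * β) x = (α x).bind β := rfl

theorem mul_eq_some {α β : PT n} {x z : Chain n} :
    (α * β) x = some z ↔ ∃ y, α x = some y ∧ β y = some z := by
  rw [mul_apply]
  exact Option.bind_eq_some_iff

def Dom (α : PT n) : Set (Chain n) := {x | ∃ y, α x = some y}

def Im (α : PT n) : Set (Chain n) := {y | ∃ x, α x = some y}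

def OrderPreserving (α : PT n) : Prop :=
  ∀ x y x' y' : Chain n, α x = some x' → α y = some y' → x < y → x' ≤ y'

def OrderReversing (α : PT n) : Prop :=
  ∀ x y x' y' : Chain n, α x = some x' → α y = some y' → x < y → y' ≤ x'

/-- Domain and image are intervals, i.e. `x ≤ y ≤ z` with `x`, `z` in the set forces `y` in it
(the empty set is an interval). -/
def HasIntervals (α : PT n) : Prop := α.Dom.OrdConnected ∧ α.Im.OrdConnected

theorem OrderPreserving.le {α : PT n} (h : α.OrderPreserving) {x y x' y' : Chain n}
    (hx : α x = some x') (hy : α y = some y') (hxy : x ≤ y) : x' ≤ y' := by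
  rcases hxy.lt_or_eq with hlt | rfl
  · exact h x y x' y' hx hy hlt
  · rw [hx] at hy
    exact (Option.some.inj hy).le

theorem OrderReversing.le {α : PT n} (h : α.OrderReversing) {x y x' y' : Chain n}
    (hx : α x = some x') (hy : α y = some y') (hxy : x ≤ y) : y' ≤ x' := by
  rcases hxy.lt_or_eq with hlt | rfl
  · exact h x y x' y' hx hy hlt
  · rw [hx] at hy
    exact (Option.some.inj hy).ge

theorem OrderPreserving.mul {α β : PT n} (hα : α.OrderPreserving) (hβ : β.OrderPreserving) :
    (α * β).OrderPreserving := by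
  intro x y x' y' hx hy hxy
  obtain ⟨u, hu, hux⟩ := mul_eq_some.1 hx
  obtain ⟨v, hv, hvy⟩ := mul_eq_some.1 hy
  exact hβ.le hux hvy (hα.le hu hv hxy.le)

theorem monotone_mul {α β : PT n} (hα : α.OrderPreserving ∨ α.OrderReversing)
    (hβ : β.OrderPreserving ∨ β.OrderReversing) :
    (α * β).OrderPreserving ∨ (α * β).OrderReversing := by
  rcases hα with hα | hα <;> rcases hβ with hβ | hβ
  · exact Or.inl (hα.mul hβ)
  · right
    intro x y x' y' hx hy hxy
    obtain ⟨u, hu, hux⟩ := mul_eq_some.1 hx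
    obtain ⟨v, hv, hvy⟩ := mul_eq_some.1 hy
    exact hβ.le hux hvy (hα.le hu hv hxy.le)
  · right
    intro x y x' y' hx hy hxy
    obtain ⟨u, hu, hux⟩ := mul_eq_some.1 hx
    obtain ⟨v, hv, hvy⟩ := mul_eq_some.1 hy
    exact hβ.le hvy hux (hα.le hu hv hxy.le)
  · left
    intro x y x' y' hx hy hxy
    obtain ⟨u, hu, hux⟩ := mul_eq_some.1 hx
    obtain ⟨v, hv, hvy⟩ := mul_eq_some.1 hy
    exact hβ.le hvy hux (hα.le hu hv hxy.le)

theorem HasIntervals.mul {α β : PT n} (mα : α.OrderPreserving ∨ α.OrderReversing)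
    (mβ : β.OrderPreserving ∨ β.OrderReversing) (hα : α.HasIntervals) (hβ : β.HasIntervals) :
    (α * β).HasIntervals := by
  constructor
  · refine ⟨fun x hx z hz y hy => ?_⟩
    obtain ⟨x', hx⟩ := hx
    obtain ⟨z', hz⟩ := hz
    obtain ⟨u, hu, hux⟩ := mul_eq_some.1 hx
    obtain ⟨w, hw, hwz⟩ := mul_eq_some.1 hz
    obtain ⟨v, hv⟩ := hα.1.out ⟨u, hu⟩ ⟨w, hw⟩ hy
    have hvβ : v ∈ β.Dom := by
      rcases mα with m | m
      · exact hβ.1.out ⟨x', hux⟩ ⟨z', hwz⟩ ⟨m.le hu hv hy.1, m.le hv hw hy.2⟩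
      · exact hβ.1.out ⟨z', hwz⟩ ⟨x', hux⟩ ⟨m.le hv hw hy.2, m.le hu hv hy.1⟩
    obtain ⟨y', hy'⟩ := hvβ
    exact ⟨y', mul_eq_some.2 ⟨v, hv, hy'⟩⟩
  · refine ⟨fun x' hx z' hz y' hy => ?_⟩
    obtain ⟨x, hx⟩ := hx
    obtain ⟨z, hz⟩ := hz
    obtain ⟨u, hu, hux⟩ := mul_eq_some.1 hx
    obtain ⟨w, hw, hwz⟩ := mul_eq_some.1 hz
    obtain ⟨v, hv⟩ := hβ.2.out ⟨u, hux⟩ ⟨w, hwz⟩ hy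
    rcases hy.1.eq_or_lt with rfl | hxy
    · exact ⟨x, hx⟩
    rcases hy.2.eq_or_lt with rfl | hyz
    · exact ⟨z, hz⟩
    have hvα : v ∈ α.Im := by
      rcases mβ with m | m
      · have h1 : u ≤ v := by
          by_contra hc
          exact absurd (m.le hv hux (le_of_not_ge hc)) (not_le_of_gt hxy)
        have h2 : v ≤ w := by
          by_contra hc
          exact absurd (m.le hwz hv (le_of_not_ge hc)) (not_le_of_gt hyz)
        exact hα.2.out ⟨x, hu⟩ ⟨z, hw⟩ ⟨h1, h2⟩
      · have h1 : v ≤ u := by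
          by_contra hc
          exact absurd (m.le hux hv (le_of_not_ge hc)) (not_le_of_gt hxy)
        have h2 : w ≤ v := by
          by_contra hc
          exact absurd (m.le hv hwz (le_of_not_ge hc)) (not_le_of_gt hyz)
        exact hα.2.out ⟨z, hw⟩ ⟨x, hu⟩ ⟨h2, h1⟩
    obtain ⟨y, hy⟩ := hvα
    exact ⟨y, mul_eq_some.2 ⟨v, hy, hv⟩⟩

theorem orderPreserving_one : (1 : PT n).OrderPreserving := by
  intro x y x' y' hx hy hxy
  obtain rfl := Option.some.inj hx
  obtain rfl := Option.some.inj hy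
  exact hxy.le

theorem hasIntervals_one : (1 : PT n).HasIntervals :=
  ⟨⟨fun _ _ _ _ y _ => ⟨y, rfl⟩⟩, ⟨fun _ _ _ _ y _ => ⟨y, rfl⟩⟩⟩

end PT

/-- Order-preserving partial transformations whose domain and image are intervals. -/
def PIOn (n : ℕ) : Submonoid (PT n) where
  carrier := {α | α.OrderPreserving ∧ α.HasIntervals}
  one_mem' := ⟨PT.orderPreserving_one, PT.hasIntervals_one⟩
  mul_mem' hα hβ := ⟨hα.1.mul hβ.1, hα.2.mul (Or.inl hα.1) (Or.inl hβ.1) hβ.2⟩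

/-- Monotone (order-preserving or order-reversing) partial transformations whose domain and
image are intervals. -/
def PIMn (n : ℕ) : Submonoid (PT n) where
  carrier := {α | (α.OrderPreserving ∨ α.OrderReversing) ∧ α.HasIntervals}
  one_mem' := ⟨Or.inl PT.orderPreserving_one, PT.hasIntervals_one⟩
  mul_mem' hα hβ := ⟨PT.monotone_mul hα.1 hβ.1, hα.2.mul hα.1 hβ.1 hβ.2⟩

/-! Monoid presentations. -/

/-- A set of relations `u = v` over the alphabet `A`. -/
abbrev Relations (A : Type) : Type := Set (FreeMonoid A × FreeMonoid A)

/-- The submonoid `S` of `M` is defined by the presentation `⟨A | R⟩`, the letter `x` standing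
for the element `φ x`: the quotient of the free monoid on `A` by the congruence generated by `R`
is isomorphic to `S`, through an isomorphism that sends the class of each letter `x` to `φ x`. -/
def DefinedBy {M A : Type} [Monoid M] (S : Submonoid M) (φ : A → M) (R : Relations A) : Prop :=
  ∃ f : PresentedMonoid (fun u v => (u, v) ∈ R) ≃* S,
    ∀ x : A, (f (PresentedMonoid.of _ x) : M) = φ x

/-! The generators. -/

/-- The alphabet `a_i, b_i, e_i` (`1 ≤ i ≤ n - 1`), `f_j` (`2 ≤ j ≤ n`). -/
inductive PIOLetter (n : ℕ) : Type
  | a (i : ℕ) (hi : 1 ≤ i ∧ i < n)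
  | b (i : ℕ) (hi : 1 ≤ i ∧ i < n)
  | e (i : ℕ) (hi : 1 ≤ i ∧ i < n)
  | f (j : ℕ) (hj : 2 ≤ j ∧ j ≤ n)

/-- The previous alphabet together with the letter `h`. -/
inductive PIMLetter (n : ℕ) : Type
  | of (x : PIOLetter n)
  | h

/-- The transformations denoted by the letters:
`a_i` fixes `1, …, i` and lowers `i + 1, …, n` by one,
`b_i` raises `1, …, i` by one and fixes `i + 1, …, n`,
`e_i` is the identity on `{1, …, i}` and `f_j` the identity on `{j, …, n}`. -/
def PIOLetter.toPT {n : ℕ} : PIOLetter n → PT n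
  | .a i hi => fun x => some (if h : x.1 ≤ i then x else ⟨x.1 - 1, by have := x.2; omega⟩)
  | .b i hi => fun x => some (if h : x.1 ≤ i then ⟨x.1 + 1, by omega⟩ else x)
  | .e i _ => fun x => if x.1 ≤ i then some x else none
  | .f j _ => fun x => if j ≤ x.1 then some x else none

/-- `h` is the reflection `x ↦ n + 1 - x`. -/
def PIMLetter.toPT {n : ℕ} : PIMLetter n → PT n
  | .of x => x.toPT
  | .h => fun x => some ⟨n + 1 - x.1, by have := x.2; omega⟩

/-! A presentation of `PIOn n`. -/

section PIORelations

variable {n : ℕ}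

/-- The one-letter words `a_i`, `b_i`, `e_i`, `f_j`. -/
def wa (i : ℕ) (hi : 1 ≤ i ∧ i < n := by omega) : FreeMonoid (PIOLetter n) :=
  FreeMonoid.of (.a i hi)

def wb (i : ℕ) (hi : 1 ≤ i ∧ i < n := by omega) : FreeMonoid (PIOLetter n) :=
  FreeMonoid.of (.b i hi)

def we (i : ℕ) (hi : 1 ≤ i ∧ i < n := by omega) : FreeMonoid (PIOLetter n) :=
  FreeMonoid.of (.e i hi)

def wf (j : ℕ) (hj : 2 ≤ j ∧ j ≤ n := by omega) : FreeMonoid (PIOLetter n) :=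
  FreeMonoid.of (.f j hj)

/-- An explicit list of relations between the generators of `PIOn n`; the word `f_n e_1` denotes
the empty transformation. -/
inductive PIORel (n : ℕ) : FreeMonoid (PIOLetter n) → FreeMonoid (PIOLetter n) → Prop
  -- full transformations
  | aa (i j : ℕ) (hi : 1 ≤ i) (hij : i ≤ j) (hj : j + 1 < n) :
      PIORel n (wa i * wa j) (wa (j + 1) * wa i)
  | aa_last (i : ℕ) (hi : 1 ≤ i) (hn : i < n) :
      PIORel n (wa i * wa (n - 1)) (wa i)
  | bb (i j : ℕ) (hj : 2 ≤ j) (hij : j ≤ i) (hi : i < n) :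
      PIORel n (wb i * wb j) (wb (j - 1) * wb i)
  | bb_first (i : ℕ) (hi : 1 ≤ i) (hn : i < n) :
      PIORel n (wb i * wb 1) (wb i)
  | ab (i j : ℕ) (hi : 1 ≤ i) (hij : i ≤ j) (hj : j + 1 < n) :
      PIORel n (wa i * wb j) (wb (j + 1) * wa (i + 1))
  | ab_last (i : ℕ) (hi : 1 ≤ i) (hn : i < n) :
      PIORel n (wa i * wb (n - 1)) (wb i)
  | ba_first (i : ℕ) (hi : 1 ≤ i) (hn : i < n) :
      PIORel n (wb i * wa 1) (wa i)
  -- partial identities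
  | ee (i j : ℕ) (hi : 1 ≤ i) (hij : i ≤ j) (hj : j < n) :
      PIORel n (we i * we j) (we i)
  | ee_succ (i : ℕ) (hi : 1 ≤ i) (hn : i + 1 < n) :
      PIORel n (we (i + 1) * we i) (we i)
  | ff (i j : ℕ) (hi : 2 ≤ i) (hij : i ≤ j) (hj : j ≤ n) :
      PIORel n (wf j * wf i) (wf j)
  | ff_succ (i : ℕ) (hi : 2 ≤ i) (hn : i < n) :
      PIORel n (wf i * wf (i + 1)) (wf (i + 1))
  | fe (i j : ℕ) (hj : 2 ≤ j) (hij : j ≤ i + 1) (hi : i < n) :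
      PIORel n (wf j * we i) (we i * wf j)
  | ef_zero (i : ℕ) (hi : 1 ≤ i) (hn : i < n) :
      PIORel n (we i * wf (i + 1)) (wa i * wf n)
  -- full transformations and partial identities
  | ea (i : ℕ) (hi : 1 ≤ i) (hn : i < n) :
      PIORel n (we i * wa i) (we i)
  | fb (i : ℕ) (hi : 1 ≤ i) (hn : i < n) :
      PIORel n (wf (i + 1) * wb i) (wf (i + 1))
  | ae (i j : ℕ) (hi : 1 ≤ i) (hij : i ≤ j) (hj : j + 1 < n) :
      PIORel n (wa i * we j) (we (j + 1) * wa i)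
  | ae_last (i : ℕ) (hi : 1 ≤ i) (hn : i < n) :
      PIORel n (wa i * we (n - 1)) (wa i)
  | ae_pred (i : ℕ) (hi : 2 ≤ i) (hn : i < n) :
      PIORel n (wa i * we (i - 1)) (we (i - 1))
  | bf (i j : ℕ) (hj : 3 ≤ j) (hij : j ≤ i + 1) (hi : i < n) :
      PIORel n (wb i * wf j) (wf (j - 1) * wb i)
  | bf_first (i : ℕ) (hi : 1 ≤ i) (hn : i < n) :
      PIORel n (wb i * wf 2) (wb i)
  | bf_succ (i : ℕ) (hi : 1 ≤ i) (hn : i + 1 < n) :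
      PIORel n (wb i * wf (i + 2)) (wf (i + 2))
  | af (i j : ℕ) (hi : 1 ≤ i) (hij : i < j) (hj : j < n) :
      PIORel n (wa i * wf j) (wf (j + 1) * wa i)
  | af_zero (i : ℕ) (hi : 1 ≤ i) (hn : i < n) :
      PIORel n (wa i * wf n) (wf n * we 1)
  | be (i j : ℕ) (hj : 2 ≤ j) (hij : j ≤ i) (hi : i < n) :
      PIORel n (wb i * we j) (we (j - 1) * wb i)
  | be_zero (i : ℕ) (hi : 1 ≤ i) (hn : i < n) :
      PIORel n (wb i * we 1) (wf n * we 1)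
  | a_zero (hn : 2 ≤ n) :
      PIORel n (wa 1 * (wf n * we 1)) (wf n * we 1)
  | b_zero (hn : 2 ≤ n) :
      PIORel n (wb (n - 1) * (wf n * we 1)) (wf n * we 1)

end PIORelations

/-- The relations above as a set of pairs of words. -/
def PIORelations (n : ℕ) : Relations (PIOLetter n) := {p | PIORel n p.1 p.2}

/-! The relations for `PIMn n`. -/

/-- The relations `N₀`, `N₁`, `N₁'` and `N₂`:
`h² = 1`; `h a_i = b_{n-i} h` and `h e_i = f_{n-i+1} h` for `1 ≤ i ≤ n - 1`;
`a_1^{n-1} h = b_{n-1}^{n-1}`. -/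
inductive NRel (n : ℕ) : FreeMonoid (PIMLetter n) → FreeMonoid (PIMLetter n) → Prop
  | N0 : NRel n (FreeMonoid.of .h * FreeMonoid.of .h) 1
  | N1 (i : ℕ) (hi : 1 ≤ i) (hn : i < n) :
      NRel n (FreeMonoid.of .h * FreeMonoid.of (.of (.a i ⟨hi, hn⟩)))
        (FreeMonoid.of (.of (.b (n - i) (by omega))) * FreeMonoid.of .h)
  | N1' (i : ℕ) (hi : 1 ≤ i) (hn : i < n) :
      NRel n (FreeMonoid.of .h * FreeMonoid.of (.of (.e i ⟨hi, hn⟩)))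
        (FreeMonoid.of (.of (.f (n - i + 1) (by omega))) * FreeMonoid.of .h)
  | N2 (hn : 2 ≤ n) :
      NRel n (FreeMonoid.of (.of (.a 1 (by omega))) ^ (n - 1) * FreeMonoid.of .h)
        (FreeMonoid.of (.of (.b (n - 1) (by omega))) ^ (n - 1))

/-- The relations `R' ∪ N₀ ∪ N₁ ∪ N₁' ∪ N₂` over the larger alphabet. -/
def RHat (n : ℕ) (R' : Relations (PIOLetter n)) : Relations (PIMLetter n) :=
  Prod.map (FreeMonoid.map PIMLetter.of) (FreeMonoid.map PIMLetter.of) '' R' ∪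
    {p | NRel n p.1 p.2}

/-! ### Presentations -/

/-! A presentation is correct when its relations hold, its letters lie in and generate the
submonoid, and words with equal values are congruent. Only the last condition is hard, and it is met
by normal forms.

For `PIOn n`, the relations move partial identities to the left, so every class is zero or `e_q f_p
w` with `p ≤ q` and `w` a product of letters `a_i`, `b_i` (`isReduced`). Because `b_i = a_i
b_{n-1}`, such a `w` is built by left multiplication with the `a_i` and `b_{n-1}` alone. Both
preserve a normal form that depends only on the map denoted: a descending product of those `a_k` for
which `k` and `k + 1` have the same image, then a power of `b_{n-1}` that fixes the image of `1`
(`genA_mul_normalForm`, `genB_last_mul_normalForm`). Thus `w` is determined by its action on the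
whole chain. The element `e_q f_p w` shows that action on `[p, q]` only, but `e_q f_p` absorbs the
retraction `clamp n p q` onto `[p, q]`, so `w` may be replaced by `clamp n p q * w`, which is
determined (`eval_injective`).

For `PIMn n`, conjugation by `h` permutes the other letters, so every word is congruent to `u` or `u
h` with `u` free of `h` (`exists_mkHat_eq`). Words of the same type are compared inside `PIOn n`. If
`u` and `v h` have the same value, then `v` preserves order and still does after reflection, so it
is constant on its domain. It then factors through the constant map `a_1^{n-1}`, and `N₂` trades
`a_1^{n-1} h` for a word without `h` (`definedBy_RHat`).

The counts rest on explicit parametrizations, shown injective by reading the parameters off the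
left-hand sides. -/

theorem definedBy_iff {M A : Type} [Monoid M] {S : Submonoid M} {φ : A → M} {R : Relations A} :
    DefinedBy S φ R ↔
      (∀ u v, (u, v) ∈ R → FreeMonoid.lift φ u = FreeMonoid.lift φ v) ∧
      (∀ x, φ x ∈ S) ∧ (∀ m ∈ S, ∃ u, FreeMonoid.lift φ u = m) ∧
      ∀ u v, FreeMonoid.lift φ u = FreeMonoid.lift φ v →
        PresentedMonoid.mk (fun u v => (u, v) ∈ R) u =
          PresentedMonoid.mk (fun u v => (u, v) ∈ R) v := by
  constructor
  · rintro ⟨f, hf⟩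
    have key : ∀ u, (f (PresentedMonoid.mk _ u) : M) = FreeMonoid.lift φ u := by
      intro u
      have : (S.subtype.comp f.toMonoidHom).comp (PresentedMonoid.mk _) = FreeMonoid.lift φ :=
        FreeMonoid.hom_eq fun x => hf x
      exact DFunLike.congr_fun this u
    refine ⟨fun u v h => ?_, fun x => ?_, fun m hm => ?_, fun u v h => ?_⟩
    · rw [← key, ← key, PresentedMonoid.mk_eq_mk_of_rel h]
    · rw [← hf x]
      exact (f _).2
    · obtain ⟨t, ht⟩ := f.surjective ⟨m, hm⟩
      obtain ⟨u, rfl⟩ := PresentedMonoid.surjective_mk t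
      exact ⟨u, by rw [← key, ht]⟩
    · apply f.injective
      apply Subtype.ext
      rw [key, key, h]
  · rintro ⟨hR, hmem, hsurj, hinj⟩
    let φ' : A → S := fun x => ⟨φ x, hmem x⟩
    have key : ∀ u, (FreeMonoid.lift φ' u : M) = FreeMonoid.lift φ u := by
      intro u
      have : S.subtype.comp (FreeMonoid.lift φ') = FreeMonoid.lift φ :=
        FreeMonoid.hom_eq fun x => by simp [φ']
      exact DFunLike.congr_fun this u
    let F : PresentedMonoid (fun u v => (u, v) ∈ R) →* S :=
      PresentedMonoid.lift φ' fun u v h => Subtype.ext (by rw [key, key, hR u v h])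
    have hF : ∀ u, F (PresentedMonoid.mk _ u) = FreeMonoid.lift φ' u := fun _ => rfl
    refine ⟨MulEquiv.ofBijective F ⟨?_, ?_⟩, fun x => rfl⟩
    · intro s t hst
      obtain ⟨u, rfl⟩ := PresentedMonoid.surjective_mk s
      obtain ⟨v, rfl⟩ := PresentedMonoid.surjective_mk t
      rw [hF, hF] at hst
      exact hinj u v (by rw [← key, ← key, hst])
    · rintro ⟨m, hm⟩
      obtain ⟨u, hu⟩ := hsurj m hm
      exact ⟨PresentedMonoid.mk _ u, Subtype.ext (by rw [hF, key, hu])⟩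

/-! ### Partial transformations as functions on natural numbers -/

namespace PT

variable {n : ℕ}

/-- The value of a partial transformation at a natural number, `0` where it is undefined. -/
def val (α : PT n) (x : ℕ) : ℕ :=
  if hx : 1 ≤ x ∧ x ≤ n then (α ⟨x, hx⟩).elim 0 (fun y => y.1) else 0

theorem val_of_eq_some {α : PT n} {x y : Chain n} (h : α x = some y) : α.val x.1 = y.1 := by
  simp [val, x.2, h]

theorem val_of_not_mem (α : PT n) {x : ℕ} (hx : ¬(1 ≤ x ∧ x ≤ n)) : α.val x = 0 := by
  simp [val, hx]

theorem val_le (α : PT n) (x : ℕ) : α.val x ≤ n := by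
  unfold val
  split_ifs with hx
  · cases α ⟨x, hx⟩ with
    | none => simp
    | some y => exact y.2.2
  · simp

/-- The default value `0` is not a point of the chain, so it cannot be mistaken for a genuine image.
-/
theorem eq_some_iff {α : PT n} {x y : Chain n} : α x = some y ↔ α.val x.1 = y.1 := by
  refine ⟨val_of_eq_some, fun h => ?_⟩
  have hy := y.2
  cases hα : α x with
  | none => simp [val, x.2, hα] at h; omega
  | some z => rw [val_of_eq_some hα] at h; rw [Subtype.ext h]

theorem ext_val {α β : PT n} (h : ∀ x, 1 ≤ x → x ≤ n → α.val x = β.val x) : α = β := by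
  funext x
  have hx := h x.1 x.2.1 x.2.2
  cases hα : α x with
  | none =>
    cases hβ : β x with
    | none => rfl
    | some z =>
      rw [val_of_eq_some hβ] at hx
      simp [val, x.2, hα] at hx
      have := z.2
      omega
  | some y =>
    rw [val_of_eq_some hα] at hx
    exact (eq_some_iff.2 hx.symm).symm

/-- Undefinedness propagates because every `val` sends `0` to `0`; products thus become plain
composition of functions on `ℕ`, which `omega` can handle. -/
theorem val_mul (α β : PT n) (x : ℕ) : (α * β).val x = β.val (α.val x) := by
  by_cases hx : 1 ≤ x ∧ x ≤ n
  · cases hα : α ⟨x, hx⟩ with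
    | none => simp [val, hx, mul_apply, hα]
    | some y => simp [val, hx, mul_apply, hα, y.2]
  · rw [val_of_not_mem _ hx, val_of_not_mem _ hx, val_of_not_mem _ (by omega)]

theorem val_one {x : ℕ} (h₁ : 1 ≤ x) (h₂ : x ≤ n) : (1 : PT n).val x = x :=
  val_of_eq_some (one_apply ⟨x, h₁, h₂⟩)

theorem val_zero (α : PT n) : α.val 0 = 0 := val_of_not_mem _ (by omega)

theorem mem_dom_iff {α : PT n} {x : Chain n} : x ∈ α.Dom ↔ α.val x.1 ≠ 0 := by
  constructor
  · rintro ⟨y, hy⟩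
    rw [val_of_eq_some hy]
    have := y.2
    omega
  · intro h
    have := α.val_le x.1
    exact ⟨⟨α.val x.1, by omega⟩, eq_some_iff.2 rfl⟩

end PT

section Letters

variable {n : ℕ}

theorem PIOLetter.val_a (i : ℕ) (hi : 1 ≤ i ∧ i < n) {x : ℕ} (h₁ : 1 ≤ x) (h₂ : x ≤ n) :
    (PIOLetter.a i hi).toPT.val x = if x ≤ i then x else x - 1 := by
  simp only [PT.val, dif_pos (And.intro h₁ h₂), PIOLetter.toPT]
  split_ifs <;> rfl

theorem PIOLetter.val_b (i : ℕ) (hi : 1 ≤ i ∧ i < n) {x : ℕ} (h₁ : 1 ≤ x) (h₂ : x ≤ n) :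
    (PIOLetter.b i hi).toPT.val x = if x ≤ i then x + 1 else x := by
  simp only [PT.val, dif_pos (And.intro h₁ h₂), PIOLetter.toPT]
  split_ifs <;> rfl

theorem PIOLetter.val_e (i : ℕ) (hi : 1 ≤ i ∧ i < n) (x : ℕ) :
    (PIOLetter.e i hi).toPT.val x = if x ≤ i then x else 0 := by
  by_cases hx : 1 ≤ x ∧ x ≤ n
  · simp only [PT.val, dif_pos hx, PIOLetter.toPT]
    split_ifs <;> rfl
  · rw [PT.val_of_not_mem _ hx]
    split_ifs <;> omega

theorem PIOLetter.val_f (j : ℕ) (hj : 2 ≤ j ∧ j ≤ n) {x : ℕ} (h₂ : x ≤ n) :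
    (PIOLetter.f j hj).toPT.val x = if j ≤ x then x else 0 := by
  by_cases hx : 1 ≤ x ∧ x ≤ n
  · simp only [PT.val, dif_pos hx, PIOLetter.toPT]
    split_ifs <;> rfl
  · rw [PT.val_of_not_mem _ hx]
    split_ifs <;> omega

theorem PIMLetter.val_h {x : ℕ} (h₁ : 1 ≤ x) (h₂ : x ≤ n) :
    (PIMLetter.h : PIMLetter n).toPT.val x = n + 1 - x := by
  simp [PT.val, PIMLetter.toPT, h₁, h₂]

end Letters

/-! ### Membership in the two monoids -/

section Membership

variable {n : ℕ}

/-- A partial transformation belongs to `PIOn n` if and only if its domain is an interval `[p, q]`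
(`q < p` being allowed) in which each step raises the value by `0` or `1`. -/
theorem mem_PIOn_iff {α : PT n} : α ∈ PIOn n ↔ ∃ p q, 1 ≤ p ∧ q ≤ n ∧
    (∀ x, α.val x ≠ 0 ↔ p ≤ x ∧ x ≤ q) ∧
    ∀ x, p ≤ x → x < q → α.val (x + 1) = α.val x ∨ α.val (x + 1) = α.val x + 1 := by
  constructor
  · rintro ⟨hop, hdom, him⟩
    by_cases hne : ∃ x, α.val x ≠ 0
    · have hb : ∀ x, α.val x ≠ 0 → 1 ≤ x ∧ x ≤ n := fun x hx => by
        by_contra h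
        exact hx (α.val_of_not_mem h)
      classical
      let s := (Finset.Icc 1 n).filter fun x => α.val x ≠ 0
      have hs : ∀ x, x ∈ s ↔ α.val x ≠ 0 := fun x => by
        simp only [s, Finset.mem_filter, Finset.mem_Icc]
        exact ⟨fun h => h.2, fun h => ⟨hb x h, h⟩⟩
      have hsne : s.Nonempty := hne.imp fun x hx => (hs x).2 hx
      have hp := (hs _).1 (s.min'_mem hsne)
      have hq := (hs _).1 (s.max'_mem hsne)
      have hiff : ∀ x, α.val x ≠ 0 ↔ s.min' hsne ≤ x ∧ x ≤ s.max' hsne := by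
        refine fun x => ⟨fun hx => ⟨s.min'_le x ((hs x).2 hx), s.le_max' x ((hs x).2 hx)⟩, ?_⟩
        rintro ⟨h₁, h₂⟩
        have := hb _ hp
        have := hb _ hq
        exact PT.mem_dom_iff.1 (hdom.out (x := ⟨_, hb _ hp⟩) (PT.mem_dom_iff.2 hp)
          (y := ⟨_, hb _ hq⟩) (PT.mem_dom_iff.2 hq)
          (show (⟨x, by omega⟩ : Chain n) ∈ _ from ⟨h₁, h₂⟩))
      refine ⟨s.min' hsne, s.max' hsne, (hb _ hp).1, (hb _ hq).2, hiff, fun x h₁ h₂ => ?_⟩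
      have hx := (hiff x).2 ⟨h₁, h₂.le⟩
      have hx' := (hiff (x + 1)).2 ⟨by omega, h₂⟩
      have hle := α.val_le x
      have hle' := α.val_le (x + 1)
      have e₁ : α ⟨x, hb x hx⟩ = some ⟨α.val x, by omega⟩ := PT.eq_some_iff.2 rfl
      have e₂ : α ⟨x + 1, hb _ hx'⟩ = some ⟨α.val (x + 1), by omega⟩ := PT.eq_some_iff.2 rfl
      have hmono : α.val x ≤ α.val (x + 1) :=
        hop.le e₁ e₂ (Subtype.mk_le_mk.2 (Nat.le_succ x))
      -- A jump of at least two would skip `α.val x + 1`, which lies in the image by convexity; a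
      -- preimage `u` fits neither to the right of `x` nor weakly to its left.
      by_contra hcon
      obtain ⟨u, hu⟩ := him.out ⟨_, e₁⟩ ⟨_, e₂⟩
        (show (⟨α.val x + 1, by omega⟩ : Chain n) ∈ Set.Icc _ _ from
          ⟨Subtype.mk_le_mk.2 (by omega), Subtype.mk_le_mk.2 (by omega)⟩)
      rcases Nat.lt_or_ge x u.1 with hlt | hge
      · have := Subtype.mk_le_mk.1 (hop.le e₂ hu (Subtype.mk_le_mk.2 hlt))
        omega
      · have := Subtype.mk_le_mk.1 (hop.le hu e₁ (Subtype.mk_le_mk.2 hge))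
        omega
    · push Not at hne
      -- The empty domain is encoded as the interval `[1, 0]`.
      exact ⟨1, 0, le_rfl, by omega, fun x => by simp [hne]; omega, fun x => by omega⟩
  · rintro ⟨p, q, hp, hq, hiff, hstep⟩
    have hmono : ∀ x d, p ≤ x → x + d ≤ q → α.val x ≤ α.val (x + d) := by
      intro x d hx
      induction d with
      | zero => simp
      | succ d ih =>
        intro h
        have := ih (by omega)
        have := hstep (x + d) (by omega) (by omega)
        rw [← add_assoc]
        omega
    -- Discrete intermediate value property: unit steps skip no value, which makes the image convex.
    have hivt : ∀ x d v, p ≤ x → x + d ≤ q → α.val x ≤ v → v ≤ α.val (x + d) →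
        ∃ y, p ≤ y ∧ y ≤ q ∧ α.val y = v := by
      intro x d v hx
      induction d with
      | zero => exact fun h h₁ h₂ => ⟨x, hx, h, le_antisymm h₁ h₂⟩
      | succ d ih =>
        intro h h₁ h₂
        rw [← add_assoc] at h₂
        rcases Nat.lt_or_ge (α.val (x + d)) v with hlt | hge
        · have := hstep (x + d) (by omega) (by omega)
          exact ⟨x + d + 1, by omega, by omega, by omega⟩
        · exact ih (by omega) h₁ hge
    have hdom : ∀ {x x' : Chain n}, α x = some x' → p ≤ x.1 ∧ x.1 ≤ q := fun {x x'} h =>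
      (hiff _).1 (PT.mem_dom_iff.1 ⟨x', h⟩)
    have hop : α.OrderPreserving := by
      intro x y x' y' hx hy hxy
      have hlt : x.1 < y.1 := hxy
      have := hmono x.1 (y.1 - x.1) (hdom hx).1 (by have := hdom hy; omega)
      rw [Nat.add_sub_cancel' hlt.le, PT.val_of_eq_some hx, PT.val_of_eq_some hy] at this
      exact this
    refine ⟨hop, ⟨fun x hx z hz y hy => ?_⟩, ⟨?_⟩⟩
    · rw [PT.mem_dom_iff, hiff] at *
      exact ⟨hx.1.trans hy.1, le_trans hy.2 hz.2⟩
    · rintro x' ⟨x, hx⟩ z' ⟨z, hz⟩ y' ⟨h₁, h₂⟩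
      rcases le_total x z with hxz | hzx
      · have hle : x.1 ≤ z.1 := hxz
        obtain ⟨y, hy₁, hy₂, hy⟩ := hivt x.1 (z.1 - x.1) y'.1 (hdom hx).1
          (by have := hdom hz; omega) (by rw [PT.val_of_eq_some hx]; exact h₁)
          (by rw [Nat.add_sub_cancel' hle, PT.val_of_eq_some hz]; exact h₂)
        exact ⟨⟨y, by omega⟩, PT.eq_some_iff.2 hy⟩
      · have : x' = y' := le_antisymm h₁ (h₂.trans (hop.le hz hx hzx))
        exact ⟨x, this ▸ hx⟩

theorem PIOLetter.toPT_mem (x : PIOLetter n) : x.toPT ∈ PIOn n := by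
  rw [mem_PIOn_iff]
  cases x with
  | a i hi =>
    refine ⟨1, n, le_rfl, le_rfl, fun x => ?_, fun x h₁ h₂ => ?_⟩
    · by_cases hx : 1 ≤ x ∧ x ≤ n
      · rw [val_a i hi hx.1 hx.2]; split_ifs <;> omega
      · rw [PT.val_of_not_mem _ hx]; omega
    · rw [val_a i hi h₁ h₂.le, val_a i hi (by omega) h₂]; split_ifs <;> omega
  | b i hi =>
    refine ⟨1, n, le_rfl, le_rfl, fun x => ?_, fun x h₁ h₂ => ?_⟩
    · by_cases hx : 1 ≤ x ∧ x ≤ n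
      · rw [val_b i hi hx.1 hx.2]; split_ifs <;> omega
      · rw [PT.val_of_not_mem _ hx]; omega
    · rw [val_b i hi h₁ h₂.le, val_b i hi (by omega) h₂]; split_ifs <;> omega
  | e i hi =>
    refine ⟨1, i, le_rfl, by omega, fun x => ?_, fun x h₁ h₂ => ?_⟩
    · rw [val_e]; split_ifs <;> omega
    · rw [val_e, val_e]; split_ifs <;> omega
  | f j hj =>
    refine ⟨j, n, by omega, le_rfl, fun x => ?_, fun x h₁ h₂ => ?_⟩
    · by_cases hx : x ≤ n
      · rw [val_f j hj hx]; split_ifs <;> omega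
      · rw [PT.val_of_not_mem _ (by omega)]; omega
    · rw [val_f j hj h₂.le, val_f j hj h₂]; split_ifs <;> omega

theorem PIOn_le_PIMn : PIOn n ≤ PIMn n := fun _ h => ⟨Or.inl h.1, h.2⟩

theorem PIMLetter.orderReversing_h : (PIMLetter.h : PIMLetter n).toPT.OrderReversing := by
  intro x y x' y' hx hy hxy
  rw [PT.eq_some_iff, PIMLetter.val_h x.2.1 x.2.2] at hx
  rw [PT.eq_some_iff, PIMLetter.val_h y.2.1 y.2.2] at hy
  have : x.1 < y.1 := hxy
  exact Subtype.mk_le_mk.2 (by omega)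

theorem PIMLetter.hasIntervals_h : (PIMLetter.h : PIMLetter n).toPT.HasIntervals := by
  constructor
  · exact ⟨fun _ _ _ _ y _ => ⟨_, rfl⟩⟩
  · refine ⟨fun _ _ _ _ y _ => ⟨⟨n + 1 - y.1, by have := y.2; omega⟩, ?_⟩⟩
    have := y.2
    rw [PT.eq_some_iff, PIMLetter.val_h (by simp only; omega) (by simp only; omega)]
    simp only
    omega

theorem PIMLetter.toPT_mem (x : PIMLetter n) : x.toPT ∈ PIMn n := by
  cases x with
  | of x => exact PIOn_le_PIMn x.toPT_mem
  | h => exact ⟨Or.inr orderReversing_h, hasIntervals_h⟩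

/-- Two reversals cancel; this reduces the order-reversing elements to `PIOn n`. -/
theorem mul_h_mem_PIOn {α : PT n} (hr : α.OrderReversing) (hi : α.HasIntervals) :
    α * (PIMLetter.h : PIMLetter n).toPT ∈ PIOn n := by
  refine ⟨?_, hi.mul (Or.inr hr) (Or.inr PIMLetter.orderReversing_h) PIMLetter.hasIntervals_h⟩
  intro x y x' y' hx hy hxy
  obtain ⟨u, hu, hux⟩ := PT.mul_eq_some.1 hx
  obtain ⟨v, hv, hvy⟩ := PT.mul_eq_some.1 hy
  exact PIMLetter.orderReversing_h.le hvy hux (hr.le hu hv hxy.le)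

theorem h_mul_h : (PIMLetter.h : PIMLetter n).toPT * (PIMLetter.h : PIMLetter n).toPT = 1 := by
  refine PT.ext_val fun x h₁ h₂ => ?_
  rw [PT.val_mul, PIMLetter.val_h h₁ h₂, PIMLetter.val_h (by omega) (by omega), PT.val_one h₁ h₂]
  omega

end Membership

/-! ### The monoid presented by `PIORelations n` -/

/-- The monoid presented by `PIORelations n`. -/
abbrev PIOPres (n : ℕ) : Type :=
  PresentedMonoid (fun u v : FreeMonoid (PIOLetter n) => (u, v) ∈ PIORelations n)

namespace PIOPres

variable {n : ℕ}

/-- The class of a word. -/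
abbrev mk (n : ℕ) : FreeMonoid (PIOLetter n) →* PIOPres n := PresentedMonoid.mk _

/-- The class of `a_i`, extended by `1` outside `1 ≤ i ≤ n - 1`. -/
def genA (n i : ℕ) : PIOPres n := if h : 1 ≤ i ∧ i < n then mk n (wa i h) else 1

/-- The class of `b_i`, extended by `1` outside `1 ≤ i ≤ n - 1`. -/
def genB (n i : ℕ) : PIOPres n := if h : 1 ≤ i ∧ i < n then mk n (wb i h) else 1

/-- The class of `e_i`, extended by `1`; in particular `e_n = 1`. -/
def genE (n i : ℕ) : PIOPres n := if h : 1 ≤ i ∧ i < n then mk n (we i h) else 1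

/-- The class of `f_j`, extended by `1`; in particular `f_1 = 1`. -/
def genF (n j : ℕ) : PIOPres n := if h : 2 ≤ j ∧ j ≤ n then mk n (wf j h) else 1

/-- The class of `f_n e_1`, which denotes the empty transformation. -/
def zero (n : ℕ) : PIOPres n := genF n n * genE n 1

theorem mk_wa (i : ℕ) (hi : 1 ≤ i ∧ i < n) : mk n (wa i hi) = genA n i := by simp [genA, hi]

theorem mk_wb (i : ℕ) (hi : 1 ≤ i ∧ i < n) : mk n (wb i hi) = genB n i := by simp [genB, hi]

theorem mk_we (i : ℕ) (hi : 1 ≤ i ∧ i < n) : mk n (we i hi) = genE n i := by simp [genE, hi]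

theorem mk_wf (j : ℕ) (hj : 2 ≤ j ∧ j ≤ n) : mk n (wf j hj) = genF n j := by simp [genF, hj]

theorem genE_last : genE n n = 1 := by simp [genE]

theorem genF_one : genF n 1 = 1 := by simp [genF]

theorem mk_eq_mk {u v : FreeMonoid (PIOLetter n)} (h : PIORel n u v) : mk n u = mk n v :=
  PresentedMonoid.mk_eq_mk_of_rel h

theorem genA_mul_genA {i j : ℕ} (hi : 1 ≤ i) (hij : i ≤ j) (hj : j + 1 < n) :
    genA n i * genA n j = genA n (j + 1) * genA n i := by
  simpa only [map_mul, mk_wa] using mk_eq_mk (PIORel.aa i j hi hij hj)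

theorem genA_mul_genA_last {i : ℕ} (hi : 1 ≤ i) (hn : i < n) :
    genA n i * genA n (n - 1) = genA n i := by
  simpa only [map_mul, mk_wa] using mk_eq_mk (PIORel.aa_last i hi hn)

theorem genA_mul_genB_last {i : ℕ} (hi : 1 ≤ i) (hn : i < n) :
    genA n i * genB n (n - 1) = genB n i := by
  simpa only [map_mul, mk_wa, mk_wb] using mk_eq_mk (PIORel.ab_last i hi hn)

theorem genB_mul_genA_first {i : ℕ} (hi : 1 ≤ i) (hn : i < n) :
    genB n i * genA n 1 = genA n i := by
  simpa only [map_mul, mk_wa, mk_wb] using mk_eq_mk (PIORel.ba_first i hi hn)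

/-- Moving `b_{n-1}` to the right over `a_{k+1}`. -/
theorem genB_last_mul_genA {k : ℕ} (hk : 1 ≤ k) (hn : k + 1 < n) :
    genB n (n - 1) * genA n (k + 1) = genA n (n - 1) * genA n k * genB n (n - 1) := by
  -- The relation `a_k b_{n-2} = b_{n-1} a_{k+1}`; its left side becomes `a_{n-1} a_k b_{n-1}` on
  -- writing `b_{n-2} = a_{n-2} b_{n-1}` and swapping `a_k a_{n-2} = a_{n-1} a_k`.
  have h := mk_eq_mk (PIORel.ab (n := n) k (n - 2) hk (by omega) (by omega))
  simp only [map_mul, mk_wa, mk_wb] at h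
  rw [show n - 2 + 1 = n - 1 by omega, ← genA_mul_genB_last (i := n - 2) (by omega) (by omega),
    ← mul_assoc, genA_mul_genA hk (by omega) (by omega), show n - 2 + 1 = n - 1 by omega] at h
  exact h.symm

theorem genE_mul_genE {i j : ℕ} (hi : 1 ≤ i) (hij : i ≤ j) : genE n i * genE n j = genE n i := by
  by_cases hj : j < n
  · simpa only [map_mul, mk_we] using mk_eq_mk (PIORel.ee i j hi hij hj)
  · simp [genE, hj]

/-- Only the neighbouring case is a relation; the rest follows by telescoping: `e_{j+1} e_i =
e_{j+1} e_j e_i = e_j e_i`. -/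
theorem genE_mul_genE_of_le {i j : ℕ} (hi : 1 ≤ i) (hij : i ≤ j) :
    genE n j * genE n i = genE n i := by
  induction j, hij using Nat.le_induction with
  | base => exact genE_mul_genE hi le_rfl
  | succ j hij ih =>
    by_cases hj : j + 1 < n
    · have h : genE n (j + 1) * genE n j = genE n j := by
        simpa only [map_mul, mk_we] using mk_eq_mk (PIORel.ee_succ j (by omega) hj)
      rw [← ih, ← mul_assoc, h]
    · simp [genE, hj]

theorem genF_mul_genF {i j : ℕ} (hij : i ≤ j) (hj : j ≤ n) :
    genF n j * genF n i = genF n j := by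
  by_cases hi' : 2 ≤ i
  · simpa only [map_mul, mk_wf] using mk_eq_mk (PIORel.ff i j hi' hij hj)
  · simp [genF, hi']

theorem genF_mul_genF_of_le {i j : ℕ} (hi : 1 ≤ i) (hij : i ≤ j) (hj : j ≤ n) :
    genF n i * genF n j = genF n j := by
  induction j, hij using Nat.le_induction with
  | base => exact genF_mul_genF le_rfl hj
  | succ j hij ih =>
    by_cases hj' : 2 ≤ j
    · have h : genF n j * genF n (j + 1) = genF n (j + 1) := by
        simpa only [map_mul, mk_wf] using mk_eq_mk (PIORel.ff_succ j hj' (by omega))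
      rw [← h, ← mul_assoc, ih (by omega)]
    · obtain rfl : i = 1 := by omega
      rw [genF_one, one_mul]

theorem genF_mul_genE {i j : ℕ} (hij : j ≤ i + 1) :
    genF n j * genE n i = genE n i * genF n j := by
  by_cases hi : 1 ≤ i ∧ i < n
  · by_cases hj' : 2 ≤ j
    · simpa only [map_mul, mk_we, mk_wf] using mk_eq_mk (PIORel.fe i j hj' hij hi.2)
    · simp [genF, hj']
  · simp [genE, hi]

theorem genE_mul_genA {i : ℕ} (hi : 1 ≤ i) (hn : i < n) : genE n i * genA n i = genE n i := by
  simpa only [map_mul, mk_we, mk_wa] using mk_eq_mk (PIORel.ea i hi hn)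

theorem genF_mul_genB {i : ℕ} (hi : 1 ≤ i) (hn : i < n) :
    genF n (i + 1) * genB n i = genF n (i + 1) := by
  simpa only [map_mul, mk_wf, mk_wb] using mk_eq_mk (PIORel.fb i hi hn)

/-! #### The zero -/

theorem genA_mul_genF_last {i : ℕ} (hi : 1 ≤ i) (hn : i < n) :
    genA n i * genF n n = zero n := by
  simpa only [map_mul, mk_we, mk_wf, mk_wa, zero] using mk_eq_mk (PIORel.af_zero i hi hn)

theorem genB_mul_genE_one {i : ℕ} (hi : 1 ≤ i) (hn : i < n) :
    genB n i * genE n 1 = zero n := by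
  simpa only [map_mul, mk_we, mk_wf, mk_wb, zero] using mk_eq_mk (PIORel.be_zero i hi hn)

theorem genE_mul_genF_succ {i : ℕ} (hi : 1 ≤ i) (hn : i < n) :
    genE n i * genF n (i + 1) = zero n := by
  rw [← genA_mul_genF_last hi hn]
  simpa only [map_mul, mk_we, mk_wf, mk_wa] using mk_eq_mk (PIORel.ef_zero i hi hn)

theorem genF_succ_mul_genE {i : ℕ} (hi : 1 ≤ i) (hn : i < n) :
    genF n (i + 1) * genE n i = zero n := by
  rw [genF_mul_genE le_rfl, genE_mul_genF_succ hi hn]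

/-- The zero can be spelled `f_n e_1`, `a_i f_n`, `b_i e_1`, `e_i f_{i+1}` or `f_{i+1} e_i`. Most
absorption laws here come from choosing the spelling whose outer factor already absorbs the
generator. -/
theorem genE_mul_zero {i : ℕ} (hi : 1 ≤ i) (hn : i < n) : genE n i * zero n = zero n := by
  rw [← genE_mul_genF_succ hi hn, ← mul_assoc, genE_mul_genE hi le_rfl]

theorem genF_mul_zero {j : ℕ} (hj : 2 ≤ j) (hn : j ≤ n) : genF n j * zero n = zero n := by
  obtain ⟨i, rfl⟩ : ∃ i, j = i + 1 := ⟨j - 1, by omega⟩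
  rw [← genF_succ_mul_genE (i := i) (by omega) (by omega), ← mul_assoc,
    genF_mul_genF le_rfl hn]

theorem zero_mul_genE {i : ℕ} (hi : 1 ≤ i) : zero n * genE n i = zero n := by
  rw [zero, mul_assoc, genE_mul_genE le_rfl hi]

theorem zero_mul_genF (hn : 2 ≤ n) {j : ℕ} (hjn : j ≤ n) :
    zero n * genF n j = zero n := by
  rw [← genA_mul_genF_last (i := 1) le_rfl hn, mul_assoc, genF_mul_genF hjn le_rfl]

theorem genA_mul_zero {i : ℕ} (hi : 1 ≤ i) (hn : i < n) : genA n i * zero n = zero n := by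
  rw [zero, ← mul_assoc, genA_mul_genF_last hi hn, zero_mul_genE le_rfl, zero]

/-- Among these products only `b_{n-1}` times zero is a listed relation; the others follow from `b_i
= a_i b_{n-1}`. -/
theorem genB_mul_zero {i : ℕ} (hi : 1 ≤ i) (hn : i < n) : genB n i * zero n = zero n := by
  have h : genB n (n - 1) * zero n = zero n := by
    simpa only [map_mul, mk_we, mk_wf, mk_wb, zero] using
      mk_eq_mk (PIORel.b_zero (n := n) (by omega))
  rw [← genA_mul_genB_last hi hn, mul_assoc, h, genA_mul_zero hi hn]

theorem zero_mul_genA {i : ℕ} (hi : 1 ≤ i) (hn : i < n) : zero n * genA n i = zero n := by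
  rw [← genF_succ_mul_genE hi hn, mul_assoc, genE_mul_genA hi hn]

theorem zero_mul_genB {i : ℕ} (hi : 1 ≤ i) (hn : i < n) : zero n * genB n i = zero n := by
  rw [← genE_mul_genF_succ hi hn, mul_assoc, genF_mul_genB hi hn]

theorem genE_mul_genF_of_lt {i j : ℕ} (hi : 1 ≤ i) (hij : i < j) (hj : j ≤ n) :
    genE n i * genF n j = zero n := by
  rw [← genF_mul_genF_of_le (i := i + 1) (by omega) hij hj, ← mul_assoc,
    genE_mul_genF_succ hi (by omega), zero_mul_genF (by omega) hj]

theorem genF_mul_genE_of_lt {i j : ℕ} (hi : 1 ≤ i) (hij : i < j) (hj : j ≤ n) :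
    genF n j * genE n i = zero n := by
  rw [← genF_mul_genF (i := i + 1) hij hj, mul_assoc,
    genF_succ_mul_genE hi (by omega), genF_mul_zero (by omega) hj]

/-! #### Moving partial identities to the left -/

theorem genA_mul_genE {i j : ℕ} (hi : 1 ≤ i) (hij : i ≤ j) (hj : j < n) :
    genA n i * genE n j = genE n (j + 1) * genA n i := by
  by_cases hj' : j + 1 < n
  · simpa only [map_mul, mk_we, mk_wa] using mk_eq_mk (PIORel.ae i j hi hij hj')
  · obtain rfl : n = j + 1 := by omega
    rw [genE_last, one_mul]
    have h := mk_eq_mk (PIORel.ae_last (n := j + 1) i hi (by omega))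
    simp only [map_mul, mk_we, mk_wa] at h
    exact h

/-- Inserting `e_{i-1}` in front of `e_j` reduces this to the listed case `j = i - 1`. -/
theorem genA_mul_genE_of_lt {i j : ℕ} (hj : 1 ≤ j) (hij : j < i) (hi : i < n) :
    genA n i * genE n j = genE n j := by
  have h : genA n i * genE n (i - 1) = genE n (i - 1) := by
    simpa only [map_mul, mk_we, mk_wa] using mk_eq_mk (PIORel.ae_pred i (by omega) hi)
  rw [← genE_mul_genE_of_le (j := i - 1) hj (by omega), ← mul_assoc, h]

theorem genB_mul_genE_of_le {i j : ℕ} (hj : 2 ≤ j) (hij : j ≤ i) (hi : i < n) :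
    genB n i * genE n j = genE n (j - 1) * genB n i := by
  simpa only [map_mul, mk_we, mk_wb] using mk_eq_mk (PIORel.be i j hj hij hi)

/-- Write `b_i = a_i b_{n-1}`: passing `b_{n-1}` lowers the index of `e_j` by one and passing `a_i`
raises it again. -/
theorem genB_mul_genE_of_lt {i j : ℕ} (hi : 1 ≤ i) (hij : i < j) (hj : j < n) :
    genB n i * genE n j = genE n j * genB n i := by
  rw [← genA_mul_genB_last hi (by omega), mul_assoc,
    genB_mul_genE_of_le (by omega) (by omega) (by omega), ← mul_assoc,
    genA_mul_genE hi (by omega) (by omega), Nat.sub_add_cancel (by omega), mul_assoc]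

theorem genB_mul_genF {i j : ℕ} (hj : 2 ≤ j) (hij : j ≤ i + 1) (hi : i < n) :
    genB n i * genF n j = genF n (j - 1) * genB n i := by
  by_cases hj' : 3 ≤ j
  · simpa only [map_mul, mk_wf, mk_wb] using mk_eq_mk (PIORel.bf i j hj' hij hi)
  · obtain rfl : j = 2 := by omega
    rw [show 2 - 1 = 1 from rfl, genF_one, one_mul]
    simpa only [map_mul, mk_wf, mk_wb] using mk_eq_mk (PIORel.bf_first i (by omega) hi)

theorem genB_mul_genF_of_lt {i j : ℕ} (hi : 1 ≤ i) (hij : i + 1 < j) (hj : j ≤ n) :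
    genB n i * genF n j = genF n j := by
  have h : genB n i * genF n (i + 2) = genF n (i + 2) := by
    simpa only [map_mul, mk_wf, mk_wb] using mk_eq_mk (PIORel.bf_succ i hi (by omega))
  rw [← genF_mul_genF_of_le (i := i + 2) (by omega) (by omega) hj, ← mul_assoc, h]

theorem genA_mul_genF_of_lt {i j : ℕ} (hi : 1 ≤ i) (hij : i < j) (hj : j < n) :
    genA n i * genF n j = genF n (j + 1) * genA n i := by
  simpa only [map_mul, mk_wf, mk_wa] using mk_eq_mk (PIORel.af i j hi hij hj)

/-- Write `a_i = b_i a_1`: passing `a_1` raises the index of `f_j` by one and passing `b_i` lowers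
it again. -/
theorem genA_mul_genF_of_le {i j : ℕ} (hj : 2 ≤ j) (hij : j ≤ i) (hi : i < n) :
    genA n i * genF n j = genF n j * genA n i := by
  rw [← genB_mul_genA_first (by omega) hi, mul_assoc,
    genA_mul_genF_of_lt le_rfl (by omega) (by omega), ← mul_assoc,
    genB_mul_genF (by omega) (by omega) hi, Nat.add_sub_cancel, mul_assoc]

/-! #### Full transformations -/

/-- The submonoid generated by the `a_i` and `b_i`. -/
def full (n : ℕ) : Submonoid (PIOPres n) :=
  Submonoid.closure {t | ∃ i, 1 ≤ i ∧ i < n ∧ (t = genA n i ∨ t = genB n i)}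

theorem genA_mem_full (n i : ℕ) : genA n i ∈ full n := by
  by_cases hi : 1 ≤ i ∧ i < n
  · exact Submonoid.subset_closure ⟨i, hi.1, hi.2, Or.inl rfl⟩
  · simp [genA, hi]

theorem genB_mem_full (n i : ℕ) : genB n i ∈ full n := by
  by_cases hi : 1 ≤ i ∧ i < n
  · exact Submonoid.subset_closure ⟨i, hi.1, hi.2, Or.inr rfl⟩
  · simp [genB, hi]

/-- The product of the `a_k` with `g (k + 1) = g k`, for `k = m, m - 1, …, 1` in this order. -/
def collapse (n : ℕ) (g : ℕ → ℕ) : ℕ → PIOPres n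
  | 0 => 1
  | m + 1 => (if g (m + 2) = g (m + 1) then genA n (m + 1) else 1) * collapse n g m

/-- The normal form of the order-preserving full transformation `g` whose image is an interval. -/
def normalForm (n : ℕ) (g : ℕ → ℕ) : PIOPres n :=
  collapse n g (n - 1) * genB n (n - 1) ^ (g 1 - 1)

theorem collapse_congr {g g' : ℕ → ℕ} {m : ℕ} (h : ∀ x, 1 ≤ x → x ≤ m + 1 → g x = g' x) :
    collapse n g m = collapse n g' m := by
  induction m with
  | zero => rfl
  | succ m ih =>
    rw [collapse, collapse, ih fun x h₁ h₂ => h x h₁ (by omega), h (m + 2) (by omega) (by omega),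
      h (m + 1) (by omega) (by omega)]

theorem normalForm_congr {g g' : ℕ → ℕ} (hn : 2 ≤ n) (h : ∀ x, 1 ≤ x → x ≤ n → g x = g' x) :
    normalForm n g = normalForm n g' := by
  rw [normalForm, normalForm, collapse_congr fun x h₁ h₂ => h x h₁ (by omega),
    h 1 le_rfl (by omega)]

/-- Here `g'` is `a_j` followed by `g`. The letter `a_j` travels right past the factors with index
`k ≥ j`, turning each `a_k` into `a_{k+1}`, and stops at its own place in the descending product,
where it records `g' (j + 1) = g' j`. -/
theorem genA_mul_collapse {g g' : ℕ → ℕ} {j : ℕ} (hj : 1 ≤ j)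
    (h₁ : ∀ x, 1 ≤ x → x ≤ j → g' x = g x) (h₂ : ∀ x, j < x → x ≤ n → g' x = g (x - 1))
    {m : ℕ} (hm : j ≤ m + 1) (hmn : m + 2 ≤ n) :
    genA n j * collapse n g m = collapse n g' (m + 1) := by
  obtain ⟨j, rfl⟩ : ∃ k, j = k + 1 := ⟨j - 1, by omega⟩
  induction m, (show j ≤ m by omega) using Nat.le_induction with
  | base =>
    rw [collapse, h₁ _ (by omega) le_rfl, h₂ (j + 2) (by omega) hmn,
      show j + 2 - 1 = j + 1 from rfl, if_pos rfl,
      collapse_congr fun x hx hx' => (h₁ x hx hx').symm]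
  | succ m hm ih =>
    rw [collapse, collapse, ← ih (by omega) (by omega), h₂ (m + 1 + 2) (by omega) hmn,
      h₂ (m + 1 + 1) (by omega) (by omega)]
    simp only [show m + 1 + 2 - 1 = m + 2 by omega, show m + 1 + 1 - 1 = m + 1 by omega]
    split_ifs
    · rw [← mul_assoc, genA_mul_genA hj (by omega) (by omega), mul_assoc]
    · simp

theorem genA_mul_normalForm {g g' : ℕ → ℕ} {j : ℕ} (hj : 1 ≤ j) (hjn : j < n)
    (h₁ : ∀ x, 1 ≤ x → x ≤ j → g' x = g x) (h₂ : ∀ x, j < x → x ≤ n → g' x = g (x - 1)) :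
    genA n j * normalForm n g = normalForm n g' := by
  rw [normalForm, normalForm, h₁ 1 le_rfl hj, ← mul_assoc]
  congr 1
  obtain ⟨m, rfl⟩ : ∃ m, n = m + 2 := ⟨n - 2, by omega⟩
  rw [show m + 2 - 1 = m + 1 from rfl,
    ← genA_mul_collapse hj h₁ h₂ (m := m) (by omega) le_rfl, collapse]
  -- A top factor `a_{n-1}` records `g n = g (n - 1)`. Since `g'` does not depend on `g n`, this
  -- factor must vanish, and it does by `a_j a_{n-1} = a_j`.
  split_ifs
  · rw [← mul_assoc]
    congr 1
    exact genA_mul_genA_last hj hjn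
  · rw [one_mul]

/-- Each passage of `b_{n-1}` over `a_{k+1}` leaves `a_k` and a stray `a_{n-1}`. The prefix `u` is
there to absorb the stray letter, and `u a_k` inherits this ability. At the end `b_{n-1}` meets
`a_1` and becomes an absorbed `a_{n-1}`, or survives if there is no `a_1`. -/
theorem mul_genB_last_mul_collapse {g g' : ℕ → ℕ} (hg : ∀ x, 1 ≤ x → x < n → g' x = g (x + 1))
    {m : ℕ} (hm : m + 2 ≤ n) {u : PIOPres n} (hu : u * genA n (n - 1) = u) :
    u * genB n (n - 1) * collapse n g (m + 1) =
      u * collapse n g' m * (if g 2 = g 1 then 1 else genB n (n - 1)) := by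
  induction m generalizing u with
  | zero =>
    simp only [collapse, zero_add, mul_one]
    split_ifs
    · rw [mul_assoc, genB_mul_genA_first (by omega) (by omega), hu, mul_one]
    · rw [mul_one]
  | succ m ih =>
    rw [collapse, collapse.eq_2 n g' m, hg (m + 2) (by omega) (by omega),
      hg (m + 1) (by omega) (by omega)]
    by_cases h : g (m + 1 + 2) = g (m + 1 + 1)
    · have hu' : u * genA n (m + 1) * genA n (n - 1) = u * genA n (m + 1) := by
        rw [mul_assoc, genA_mul_genA_last (by omega) (by omega)]
      rw [if_pos h, if_pos h, ← mul_assoc, ← mul_assoc, ← ih (by omega) hu']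
      congr 1
      rw [mul_assoc, genB_last_mul_genA (by omega) (by omega), mul_assoc, ← mul_assoc u, hu,
        mul_assoc]
    · rw [if_neg h, if_neg h, one_mul, one_mul]
      exact ih (by omega) hu

theorem genB_last_mul_normalForm {g g' : ℕ → ℕ} (hn : 2 ≤ n)
    (hg : ∀ x, 1 ≤ x → x < n → g' x = g (x + 1)) (hgn : g' n = g n) (hpos : 1 ≤ g 1)
    (hstep : g 2 = g 1 ∨ g 2 = g 1 + 1) :
    genB n (n - 1) * normalForm n g = normalForm n g' := by
  obtain ⟨m, rfl⟩ : ∃ m, n = m + 2 := ⟨n - 2, by omega⟩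
  -- The choice `u = a_{n-1}` serves twice: `b_{n-1} = a_{n-1} b_{n-1}`, and `a_{n-1}` is the top
  -- factor for `g'`, because `g' n = g' (n - 1)`.
  have key := mul_genB_last_mul_collapse (n := m + 2) hg le_rfl (u := genA (m + 2) (m + 1))
    (genA_mul_genA_last (by omega) (by omega))
  rw [genA_mul_genB_last (by omega) (by omega)] at key
  rw [normalForm, normalForm, ← mul_assoc, show m + 2 - 1 = m + 1 from rfl, key,
    collapse.eq_2 _ g' m, hgn, hg (m + 1) (by omega) (by omega), if_pos rfl,
    hg 1 le_rfl (by omega), mul_assoc (_ * _)]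
  congr 1
  rcases hstep with h | h
  · simp [h]
  · rw [if_neg (by omega), show m + 2 - 1 = m + 1 from rfl, ← pow_succ', h]
    congr 1
    omega

end PIOPres

/-! ### The presentation of `PIOn n` -/

section Soundness

variable {n : ℕ}

/-- Stated without bounds on `x`, so that `simp` can evaluate nested products with no side goals. -/
theorem PIOLetter.val_a_apply (i : ℕ) (hi : 1 ≤ i ∧ i < n) (x : ℕ) :
    (PIOLetter.a i hi).toPT.val x =
      if 1 ≤ x ∧ x ≤ n then if x ≤ i then x else x - 1 else 0 := by
  split_ifs with h h'
  · rw [val_a i hi h.1 h.2, if_pos h']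
  · rw [val_a i hi h.1 h.2, if_neg h']
  · exact PT.val_of_not_mem _ h

theorem PIOLetter.val_b_apply (i : ℕ) (hi : 1 ≤ i ∧ i < n) (x : ℕ) :
    (PIOLetter.b i hi).toPT.val x =
      if 1 ≤ x ∧ x ≤ n then if x ≤ i then x + 1 else x else 0 := by
  split_ifs with h h'
  · rw [val_b i hi h.1 h.2, if_pos h']
  · rw [val_b i hi h.1 h.2, if_neg h']
  · exact PT.val_of_not_mem _ h

theorem PIOLetter.val_f_apply (j : ℕ) (hj : 2 ≤ j ∧ j ≤ n) (x : ℕ) :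
    (PIOLetter.f j hj).toPT.val x = if j ≤ x ∧ x ≤ n then x else 0 := by
  by_cases hx : x ≤ n
  · rw [val_f j hj hx]
    simp [hx]
  · rw [PT.val_of_not_mem _ (by omega)]
    simp [hx]

theorem PIORel.lift_eq {u v : FreeMonoid (PIOLetter n)} (h : PIORel n u v) :
    FreeMonoid.lift PIOLetter.toPT u = FreeMonoid.lift PIOLetter.toPT v := by
  refine PT.ext_val fun x h₁ h₂ => ?_
  cases h <;>
  simp only [map_mul, wa, wb, we, wf, FreeMonoid.lift_eval_of, PT.val_mul, PIOLetter.val_a_apply,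
    PIOLetter.val_b_apply, PIOLetter.val_e, PIOLetter.val_f_apply] <;>
  split_ifs <;> omega

end Soundness

namespace PIOPres

variable {n : ℕ}

/-- The transformation denoted by an element of the presented monoid. -/
def eval (n : ℕ) : PIOPres n →* PT n :=
  PresentedMonoid.lift PIOLetter.toPT fun _ _ h => PIORel.lift_eq h

/-- The action of an element of the presented monoid on natural numbers. -/
def act (t : PIOPres n) (x : ℕ) : ℕ := (eval n t).val x

theorem act_mul (s t : PIOPres n) (x : ℕ) : act (s * t) x = act t (act s x) := by
  rw [act, map_mul, PT.val_mul]
  rfl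

theorem act_one {x : ℕ} (h₁ : 1 ≤ x) (h₂ : x ≤ n) : act (1 : PIOPres n) x = x := by
  rw [act, map_one, PT.val_one h₁ h₂]

theorem act_zero_right (t : PIOPres n) : act t 0 = 0 := PT.val_zero _

theorem act_genA {i : ℕ} (hi : 1 ≤ i) (hn : i < n) {x : ℕ} (h₁ : 1 ≤ x) (h₂ : x ≤ n) :
    act (genA n i) x = if x ≤ i then x else x - 1 := by
  rw [genA, dif_pos ⟨hi, hn⟩]
  exact PIOLetter.val_a i ⟨hi, hn⟩ h₁ h₂

theorem act_genB {i : ℕ} (hi : 1 ≤ i) (hn : i < n) {x : ℕ} (h₁ : 1 ≤ x) (h₂ : x ≤ n) :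
    act (genB n i) x = if x ≤ i then x + 1 else x := by
  rw [genB, dif_pos ⟨hi, hn⟩]
  exact PIOLetter.val_b i ⟨hi, hn⟩ h₁ h₂

theorem act_genE {i : ℕ} (hi : 1 ≤ i) {x : ℕ} (h₁ : 1 ≤ x) (h₂ : x ≤ n) :
    act (genE n i) x = if x ≤ i then x else 0 := by
  by_cases hn : i < n
  · rw [genE, dif_pos ⟨hi, hn⟩]
    exact PIOLetter.val_e i ⟨hi, hn⟩ x
  · rw [genE, dif_neg (by omega), act_one h₁ h₂, if_pos (by omega)]

theorem act_genF {j : ℕ} (hj : j ≤ n) {x : ℕ} (h₁ : 1 ≤ x) (h₂ : x ≤ n) :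
    act (genF n j) x = if j ≤ x then x else 0 := by
  by_cases hj' : 2 ≤ j
  · rw [genF, dif_pos ⟨hj', hj⟩]
    exact PIOLetter.val_f j ⟨hj', hj⟩ h₂
  · rw [genF, dif_neg (by omega), act_one h₁ h₂, if_pos (by omega)]

theorem act_genE_genF_mul {p q : ℕ} (hq : 1 ≤ q) (hp : p ≤ n) (w : PIOPres n) {x : ℕ}
    (h₁ : 1 ≤ x) (h₂ : x ≤ n) :
    act (genE n q * genF n p * w) x = if p ≤ x ∧ x ≤ q then act w x else 0 := by
  rw [act_mul, act_mul, act_genE hq h₁ h₂]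
  by_cases hxq : x ≤ q
  · rw [if_pos hxq, act_genF hp h₁ h₂]
    by_cases hpx : p ≤ x
    · rw [if_pos hpx, if_pos ⟨hpx, hxq⟩]
    · rw [if_neg hpx, if_neg (by omega), act_zero_right]
  · rw [if_neg hxq, if_neg (by omega), act_zero_right, act_zero_right]

theorem act_zero (hn : 2 ≤ n) {x : ℕ} (h₁ : 1 ≤ x) (h₂ : x ≤ n) : act (zero n) x = 0 := by
  rw [zero, act_mul, act_genF le_rfl h₁ h₂]
  split_ifs
  · rw [act_genE le_rfl h₁ h₂, if_neg (by omega)]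
  · exact act_zero_right _

/-! #### Elements of the full part -/

/-- `g` is a full order-preserving transformation of the chain whose image is an interval. -/
structure IsFull (n : ℕ) (g : ℕ → ℕ) : Prop where
  pos : ∀ x, 1 ≤ x → x ≤ n → 1 ≤ g x
  le : ∀ x, 1 ≤ x → x ≤ n → g x ≤ n
  step : ∀ x, 1 ≤ x → x < n → g (x + 1) = g x ∨ g (x + 1) = g x + 1

theorem isFull_genA_mul {w : PIOPres n} (hw : IsFull n (act w)) {i : ℕ} (hi : 1 ≤ i)
    (hn : i < n) : IsFull n (act (genA n i * w)) where
  pos x h₁ h₂ := by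
    rw [act_mul, act_genA hi hn h₁ h₂]
    split_ifs
    · exact hw.pos _ h₁ h₂
    · exact hw.pos _ (by omega) (by omega)
  le x h₁ h₂ := by
    rw [act_mul, act_genA hi hn h₁ h₂]
    split_ifs
    · exact hw.le _ h₁ h₂
    · exact hw.le _ (by omega) (by omega)
  step x h₁ h₂ := by
    rw [act_mul, act_mul, act_genA hi hn h₁ h₂.le, act_genA hi hn (by omega) h₂]
    rcases lt_trichotomy x i with h | h | h
    · rw [if_pos (Nat.succ_le_of_lt h), if_pos h.le]
      exact hw.step x h₁ h₂
    · rw [if_neg (by omega), if_pos h.le]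
      exact Or.inl rfl
    · rw [if_neg (by omega), if_neg (by omega)]
      have := hw.step (x - 1) (by omega) (by omega)
      rwa [Nat.sub_add_cancel (by omega)] at this

theorem isFull_genB_last_mul {w : PIOPres n} (hn : 2 ≤ n) (hw : IsFull n (act w)) :
    IsFull n (act (genB n (n - 1) * w)) where
  pos x h₁ h₂ := by
    rw [act_mul, act_genB (by omega) (by omega) h₁ h₂]
    split_ifs
    · exact hw.pos _ (by omega) (by omega)
    · exact hw.pos _ h₁ h₂
  le x h₁ h₂ := by
    rw [act_mul, act_genB (by omega) (by omega) h₁ h₂]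
    split_ifs
    · exact hw.le _ (by omega) (by omega)
    · exact hw.le _ h₁ h₂
  step x h₁ h₂ := by
    rw [act_mul, act_mul, act_genB (by omega) (by omega) h₁ h₂.le,
      act_genB (by omega) (by omega) (by omega) h₂, if_pos (show x ≤ n - 1 by omega)]
    split_ifs
    · exact hw.step (x + 1) (by omega) (by omega)
    · exact Or.inl rfl

/-- Every product of `a_i`'s and `b_i`'s equals the normal form of the transformation it
denotes. -/
theorem isFull_and_eq_normalForm (hn : 2 ≤ n) {w : PIOPres n} (hw : w ∈ full n) :
    IsFull n (act w) ∧ w = normalForm n (act w) := by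
  have hA : ∀ {w : PIOPres n} {i : ℕ}, 1 ≤ i → i < n →
      IsFull n (act w) ∧ w = normalForm n (act w) →
      IsFull n (act (genA n i * w)) ∧ genA n i * w = normalForm n (act (genA n i * w)) := by
    rintro w i hi hin ⟨hw, he⟩
    refine ⟨isFull_genA_mul hw hi hin, ?_⟩
    nth_rw 1 [he]
    refine genA_mul_normalForm hi hin (fun x h₁ h₂ => ?_) fun x h₁ h₂ => ?_
    · rw [act_mul, act_genA hi hin h₁ (by omega), if_pos h₂]
    · rw [act_mul, act_genA hi hin (by omega) h₂, if_neg (by omega)]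
  have hB : ∀ {w : PIOPres n}, IsFull n (act w) ∧ w = normalForm n (act w) →
      IsFull n (act (genB n (n - 1) * w)) ∧
        genB n (n - 1) * w = normalForm n (act (genB n (n - 1) * w)) := by
    rintro w ⟨hw, he⟩
    refine ⟨isFull_genB_last_mul hn hw, ?_⟩
    nth_rw 1 [he]
    refine genB_last_mul_normalForm hn (fun x h₁ h₂ => ?_) ?_ (hw.pos 1 le_rfl (by omega))
      (hw.step 1 le_rfl (by omega))
    · rw [act_mul, act_genB (by omega) (by omega) h₁ (by omega), if_pos (by omega)]
    · rw [act_mul, act_genB (by omega) (by omega) (by omega) le_rfl, if_neg (by omega)]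
  induction hw using Submonoid.closure_induction_left with
  | one =>
    constructor
    · constructor
      · intro x h₁ h₂
        rwa [act_one h₁ h₂]
      · intro x h₁ h₂
        rwa [act_one h₁ h₂]
      · intro x h₁ h₂
        rw [act_one h₁ h₂.le, act_one (by omega) h₂]
        exact Or.inr rfl
    · have h : ∀ m, m < n → collapse n (act (1 : PIOPres n)) m = 1 := by
        intro m
        induction m with
        | zero => exact fun _ => rfl
        | succ m ih =>
          intro hm
          rw [collapse, ih (by omega), act_one (by omega) (by omega),
            act_one (by omega) (by omega), if_neg (by omega), one_mul]
      rw [normalForm, h _ (by omega), act_one le_rfl (by omega), Nat.sub_self, pow_zero, one_mul]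
  | mul_left x hx w hw ih =>
    obtain ⟨i, hi, hin, rfl | rfl⟩ := hx
    · exact hA hi hin ih
    -- Any `b_i` is `a_i b_{n-1}`, so the two cases `hA` and `hB` suffice.
    · rw [← genA_mul_genB_last hi hin, mul_assoc]
      exact hA hi hin (hB ih)

theorem eq_of_act_eq_of_mem_full (hn : 2 ≤ n) {w w' : PIOPres n} (hw : w ∈ full n)
    (hw' : w' ∈ full n) (h : ∀ x, 1 ≤ x → x ≤ n → act w x = act w' x) : w = w' := by
  rw [(isFull_and_eq_normalForm hn hw).2, (isFull_and_eq_normalForm hn hw').2]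
  exact normalForm_congr hn h

/-- Up to `m + 1` the product acts as `g` translated to start at `1`; beyond that it continues with
slope one. The additive form avoids truncated subtraction. -/
theorem act_collapse {g : ℕ → ℕ} (hg : IsFull n g) {m : ℕ} (hm : m < n) {x : ℕ} (h₁ : 1 ≤ x)
    (h₂ : x ≤ n) :
    act (collapse n g m) x + g 1 = g (min x (m + 1)) + (x - min x (m + 1)) + 1 := by
  induction m generalizing x with
  | zero =>
    rw [collapse, act_one h₁ h₂, show min x (0 + 1) = 1 by omega]
    omega
  | succ m ih =>
    rw [collapse, act_mul]
    by_cases hx : x ≤ m + 1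
    · have : act (if g (m + 2) = g (m + 1) then genA n (m + 1) else 1) x = x := by
        split_ifs
        · rw [act_genA (by omega) hm h₁ h₂, if_pos hx]
        · rw [act_one h₁ h₂]
      rw [this, ih (by omega) h₁ h₂, min_eq_left hx, min_eq_left (by omega)]
    · rw [show min x (m + 1 + 1) = m + 2 by omega]
      split_ifs with h
      · rw [act_genA (by omega) hm h₁ h₂, if_neg hx, ih (by omega) (by omega) (by omega),
          show min (x - 1) (m + 1) = m + 1 by omega, h]
        omega
      · rw [act_one h₁ h₂, ih (by omega) h₁ h₂, show min x (m + 1) = m + 1 by omega]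
        have : g (m + 2) = g (m + 1) ∨ g (m + 2) = g (m + 1) + 1 := hg.step (m + 1) (by omega) hm
        omega

/-- Points up to `i` climb one step per factor and stop at `i + 1`; the outer `max` covers the
points that never move. -/
theorem act_genB_pow {i : ℕ} (hi : 1 ≤ i) (hn : i < n) (k : ℕ) {x : ℕ} (h₁ : 1 ≤ x)
    (h₂ : x ≤ n) : act (genB n i ^ k) x = max x (min (x + k) (i + 1)) := by
  induction k generalizing x with
  | zero =>
    rw [pow_zero, act_one h₁ h₂]
    omega
  | succ k ih =>
    rw [pow_succ', act_mul, act_genB hi hn h₁ h₂]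
    split_ifs
    · rw [ih (by omega) (by omega)]
      omega
    · rw [ih h₁ h₂]
      omega

theorem act_genA_pow {i : ℕ} (hi : 1 ≤ i) (hn : i < n) (k : ℕ) {x : ℕ} (h₁ : 1 ≤ x)
    (h₂ : x ≤ n) : act (genA n i ^ k) x = min x (max (x - k) i) := by
  induction k generalizing x with
  | zero =>
    rw [pow_zero, act_one h₁ h₂]
    omega
  | succ k ih =>
    rw [pow_succ', act_mul, act_genA hi hn h₁ h₂]
    split_ifs
    · rw [ih h₁ h₂]
      omega
    · rw [ih (by omega) (by omega)]
      omega

theorem act_normalForm (hn : 2 ≤ n) {g : ℕ → ℕ} (hg : IsFull n g) {x : ℕ} (h₁ : 1 ≤ x)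
    (h₂ : x ≤ n) : act (normalForm n g) x = g x := by
  have hle := (hg.le x h₁ h₂)
  have h := act_collapse hg (m := n - 1) (by omega) h₁ h₂
  rw [show min x (n - 1 + 1) = x by omega] at h
  -- `act_genB_pow` needs a point of the chain; the value `0` would force `g x < g 1`, against
  -- monotonicity.
  have hpos : 1 ≤ act (collapse n g (n - 1)) x := by
    by_contra h0
    have hmono : ∀ d, d < n → g 1 ≤ g (1 + d) := by
      intro d
      induction d with
      | zero => simp
      | succ d ih =>
        intro hd
        have := ih (by omega)
        have := hg.step (1 + d) (by omega) (by omega)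
        rw [← add_assoc]
        omega
    have := hmono (x - 1) (by omega)
    rw [Nat.add_sub_cancel' h₁] at this
    omega
  have hpos' := hg.pos 1 le_rfl (by omega)
  rw [normalForm, act_mul, act_genB_pow (by omega) (by omega) _ hpos (by omega)]
  omega

/-! #### Reduction of an arbitrary element -/

theorem zero_mul_of_mem_full {w : PIOPres n} (hw : w ∈ full n) : zero n * w = zero n := by
  induction hw using Submonoid.closure_induction_left with
  | one => rw [mul_one]
  | mul_left x hx w hw ih =>
    obtain ⟨i, hi, hin, rfl | rfl⟩ := hx
    · rw [← mul_assoc, zero_mul_genA hi hin, ih]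
    · rw [← mul_assoc, zero_mul_genB hi hin, ih]

/-- `t` is the zero, or a partial identity followed by a full transformation. -/
def IsReduced (t : PIOPres n) : Prop :=
  t = zero n ∨ ∃ p q w, 1 ≤ p ∧ p ≤ q ∧ q ≤ n ∧ w ∈ full n ∧ t = genE n q * genF n p * w

/-- If `q < p`, the two partial identities have disjoint domains and the product is zero, so no
comparison of `p` and `q` is needed when the lemma is applied. -/
theorem isReduced_genE_genF_mul {p q : ℕ} (hp : 1 ≤ p) (hpn : p ≤ n) (hq : 1 ≤ q) (hqn : q ≤ n)
    {w : PIOPres n} (hw : w ∈ full n) : IsReduced (genE n q * genF n p * w) := by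
  by_cases h : p ≤ q
  · exact Or.inr ⟨p, q, w, hp, h, hqn, hw, rfl⟩
  · left
    rw [genE_mul_genF_of_lt hq (by omega) hpn, zero_mul_of_mem_full hw]

theorem isReduced_genE_zero_mul {q : ℕ} (hq : 1 ≤ q) (hqn : q ≤ n) {w : PIOPres n}
    (hw : w ∈ full n) : IsReduced (genE n q * zero n * w) := by
  left
  rcases hqn.lt_or_eq with h | rfl
  · rw [genE_mul_zero hq h, zero_mul_of_mem_full hw]
  · rw [genE_last, one_mul, zero_mul_of_mem_full hw]

/-- How `f_p` passes `a_i` depends on the position of `p` relative to `i`; for `p = n` the product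
vanishes because `n` is not in the image of `a_i`. -/
theorem isReduced_genE_mul_genA_mul_genF {i p q : ℕ} (hi : 1 ≤ i) (hin : i < n) (hp : 1 ≤ p)
    (hpn : p ≤ n) (hq : 1 ≤ q) (hqn : q ≤ n) {w : PIOPres n} (hw : w ∈ full n) :
    IsReduced (genE n q * (genA n i * genF n p) * w) := by
  have hw' := mul_mem (genA_mem_full n i) hw
  by_cases h₁ : p = 1
  · rw [h₁, genF_one, mul_one, mul_assoc, ← mul_one (genE n q), ← genF_one]
    exact isReduced_genE_genF_mul le_rfl (by omega) hq hqn hw'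
  by_cases h₂ : p ≤ i
  · rw [genA_mul_genF_of_le (by omega) h₂ hin, ← mul_assoc, mul_assoc _ _ w]
    exact isReduced_genE_genF_mul hp hpn hq hqn hw'
  by_cases h₃ : p < n
  · rw [genA_mul_genF_of_lt hi (by omega) h₃, ← mul_assoc, mul_assoc _ _ w]
    exact isReduced_genE_genF_mul (by omega) h₃ hq hqn hw'
  · obtain rfl : p = n := by omega
    rw [genA_mul_genF_last hi hin]
    exact isReduced_genE_zero_mul hq hqn hw

theorem isReduced_genE_mul_genB_mul_genF {i p q : ℕ} (hi : 1 ≤ i) (hin : i < n) (hp : 1 ≤ p)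
    (hpn : p ≤ n) (hq : 1 ≤ q) (hqn : q ≤ n) {w : PIOPres n} (hw : w ∈ full n) :
    IsReduced (genE n q * (genB n i * genF n p) * w) := by
  have hw' := mul_mem (genB_mem_full n i) hw
  by_cases h₁ : p = 1
  · rw [h₁, genF_one, mul_one, mul_assoc, ← mul_one (genE n q), ← genF_one]
    exact isReduced_genE_genF_mul le_rfl (by omega) hq hqn hw'
  by_cases h₂ : p ≤ i + 1
  · rw [genB_mul_genF (by omega) h₂ hin, ← mul_assoc, mul_assoc _ _ w]
    exact isReduced_genE_genF_mul (by omega) (by omega) hq hqn hw'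
  · rw [genB_mul_genF_of_lt hi (by omega) hpn]
    exact isReduced_genE_genF_mul hp hpn hq hqn hw

theorem IsReduced.genA_mul {t : PIOPres n} (ht : IsReduced t) {i : ℕ} (hi : 1 ≤ i)
    (hin : i < n) : IsReduced (genA n i * t) := by
  obtain rfl | ⟨p, q, w, hp, hpq, hqn, hw, rfl⟩ := ht
  · exact Or.inl (genA_mul_zero hi hin)
  rw [← mul_assoc, ← mul_assoc]
  rcases hqn.lt_or_eq with h | rfl
  · by_cases hiq : i ≤ q
    · rw [genA_mul_genE hi hiq h, mul_assoc (genE _ _)]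
      exact isReduced_genE_mul_genA_mul_genF hi hin hp (by omega) (by omega) h hw
    · rw [genA_mul_genE_of_lt (by omega) (by omega) hin]
      exact isReduced_genE_genF_mul hp (by omega) (by omega) hqn hw
  · rw [genE_last, mul_one, ← one_mul (genA q i * genF q p), ← genE_last]
    exact isReduced_genE_mul_genA_mul_genF hi hin hp (by omega) (by omega) le_rfl hw

theorem IsReduced.genB_mul {t : PIOPres n} (ht : IsReduced t) {i : ℕ} (hi : 1 ≤ i)
    (hin : i < n) : IsReduced (genB n i * t) := by
  obtain rfl | ⟨p, q, w, hp, hpq, hqn, hw, rfl⟩ := ht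
  · exact Or.inl (genB_mul_zero hi hin)
  rw [← mul_assoc, ← mul_assoc]
  rcases hqn.lt_or_eq with h | rfl
  · by_cases hiq : i < q
    · rw [genB_mul_genE_of_lt hi hiq h, mul_assoc (genE _ _)]
      exact isReduced_genE_mul_genB_mul_genF hi hin hp (by omega) (by omega) hqn hw
    by_cases hq : 2 ≤ q
    · rw [genB_mul_genE_of_le hq (by omega) hin, mul_assoc (genE _ _)]
      exact isReduced_genE_mul_genB_mul_genF hi hin hp (by omega) (by omega) (by omega) hw
    -- The point `1` is not in the image of `b_i`, so `b_i e_1` is zero.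
    · obtain rfl : q = 1 := by omega
      rw [genB_mul_genE_one hi hin, zero_mul_genF (by omega) (by omega)]
      exact Or.inl (zero_mul_of_mem_full hw)
  · rw [genE_last, mul_one, ← one_mul (genB q i * genF q p), ← genE_last]
    exact isReduced_genE_mul_genB_mul_genF hi hin hp (by omega) (by omega) le_rfl hw

theorem IsReduced.genE_mul {t : PIOPres n} (ht : IsReduced t) {i : ℕ} (hi : 1 ≤ i)
    (hin : i < n) : IsReduced (genE n i * t) := by
  obtain rfl | ⟨p, q, w, hp, hpq, hqn, hw, rfl⟩ := ht
  · exact Or.inl (genE_mul_zero hi hin)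
  rw [← mul_assoc, ← mul_assoc]
  rcases le_total i q with h | h
  · rw [genE_mul_genE hi h]
    exact isReduced_genE_genF_mul hp (by omega) hi hin.le hw
  · rw [genE_mul_genE_of_le (by omega) h]
    exact isReduced_genE_genF_mul hp (by omega) (by omega) hqn hw

theorem IsReduced.genF_mul {t : PIOPres n} (ht : IsReduced t) {j : ℕ} (hj : 2 ≤ j)
    (hjn : j ≤ n) : IsReduced (genF n j * t) := by
  obtain rfl | ⟨p, q, w, hp, hpq, hqn, hw, rfl⟩ := ht
  · exact Or.inl (genF_mul_zero hj hjn)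
  rw [← mul_assoc, ← mul_assoc]
  by_cases hjq : j ≤ q
  · rw [genF_mul_genE (by omega), mul_assoc (genE _ _)]
    rcases le_total j p with h | h
    · rw [genF_mul_genF_of_le (by omega) h (by omega)]
      exact isReduced_genE_genF_mul hp (by omega) (by omega) hqn hw
    · rw [genF_mul_genF h hjn]
      exact isReduced_genE_genF_mul (by omega) hjn (by omega) hqn hw
  · rw [genF_mul_genE_of_lt (by omega) (by omega) hjn, zero_mul_genF (by omega) (by omega)]
    exact Or.inl (zero_mul_of_mem_full hw)

theorem isReduced (hn : 2 ≤ n) (t : PIOPres n) : IsReduced t := by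
  refine Submonoid.induction_of_closure_eq_top_left (PresentedMonoid.closure_range_of _) t ?_ ?_
  · exact Or.inr ⟨1, n, 1, le_rfl, by omega, le_rfl, one_mem _, by simp [genE_last, genF_one]⟩
  · rintro _ ⟨x, rfl⟩ t ht
    cases x with
    | a i hi =>
      have h := ht.genA_mul hi.1 hi.2
      rwa [← mk_wa i hi] at h
    | b i hi =>
      have h := ht.genB_mul hi.1 hi.2
      rwa [← mk_wb i hi] at h
    | e i hi =>
      have h := ht.genE_mul hi.1 hi.2
      rwa [← mk_we i hi] at h
    | f j hj =>
      have h := ht.genF_mul hj.1 hj.2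
      rwa [← mk_wf j hj] at h

/-! #### Faithfulness and surjectivity of the action -/

/-- The full transformation that moves every point to the nearest point of `[p, q]`. -/
def clamp (n p q : ℕ) : PIOPres n := genB n (p - 1) ^ (p - 1) * genA n q ^ (n - q)

theorem clamp_mem_full (n p q : ℕ) : clamp n p q ∈ full n :=
  mul_mem (pow_mem (genB_mem_full _ _) _) (pow_mem (genA_mem_full _ _) _)

/-- The factor `f_p` absorbs `b_{p-1}` and `e_q` absorbs `a_q`; the commutation of `e_q` with `f_p`
brings each next to its partner. -/
theorem genE_mul_genF_mul_clamp {p q : ℕ} (hp : 1 ≤ p) (hpq : p ≤ q) (hqn : q ≤ n) :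
    genE n q * genF n p * clamp n p q = genE n q * genF n p := by
  have hpow : ∀ {s t : PIOPres n}, s * t = s → ∀ k, s * t ^ k = s := by
    intro s t h k
    induction k with
    | zero => simp
    | succ k ih => rw [pow_succ', ← mul_assoc, h, ih]
  have hB : genF n p * genB n (p - 1) ^ (p - 1) = genF n p := by
    rcases hp.eq_or_lt with rfl | hp
    · simp
    obtain ⟨i, rfl⟩ : ∃ i, p = i + 1 := ⟨p - 1, by omega⟩
    exact hpow (genF_mul_genB (by omega) (by omega)) _
  have hA : genE n q * genA n q ^ (n - q) = genE n q := by
    rcases hqn.eq_or_lt with rfl | hq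
    · simp
    exact hpow (genE_mul_genA (by omega) hq) _
  rw [clamp, ← mul_assoc, mul_assoc (genE n q), hB, ← genF_mul_genE (by omega), mul_assoc, hA]

theorem act_clamp {p q : ℕ} (hp : 1 ≤ p) (hpq : p ≤ q) (hqn : q ≤ n) {x : ℕ} (h₁ : 1 ≤ x)
    (h₂ : x ≤ n) : act (clamp n p q) x = min (max x p) q := by
  have hB : act (genB n (p - 1) ^ (p - 1)) x = max x p := by
    rcases hp.eq_or_lt with rfl | hp
    · rw [Nat.sub_self, pow_zero, act_one h₁ h₂]
      omega
    · rw [act_genB_pow (by omega) (by omega) _ h₁ h₂]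
      omega
  rw [clamp, act_mul, hB]
  rcases hqn.eq_or_lt with rfl | hq
  · rw [Nat.sub_self, pow_zero, act_one (by omega) (by omega)]
    omega
  · rw [act_genA_pow (by omega) hq _ (by omega) (by omega)]
    omega

theorem act_pos_of_mem_full (hn : 2 ≤ n) {w : PIOPres n} (hw : w ∈ full n) {x : ℕ} (h₁ : 1 ≤ x)
    (h₂ : x ≤ n) : 1 ≤ act w x :=
  (isFull_and_eq_normalForm hn hw).1.pos x h₁ h₂

/-- Zero is the only reduced form with empty domain. For two others the domain gives back `p` and
`q`, and the full parts agree once they are preceded by the retraction onto `[p, q]`. -/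
theorem eval_injective (hn : 2 ≤ n) : Function.Injective (eval n) := by
  intro s t hst
  have hact : ∀ x, act s x = act t x := fun x => by rw [act, act, hst]
  clear hst
  obtain rfl | ⟨p, q, w, hp, hpq, hqn, hw, rfl⟩ := isReduced hn s <;>
  obtain rfl | ⟨p', q', w', hp', hpq', hqn', hw', rfl⟩ := isReduced hn t
  · rfl
  · have h := hact p'
    rw [act_zero hn hp' (by omega), act_genE_genF_mul (by omega) (by omega) _ hp' (by omega),
      if_pos ⟨le_rfl, hpq'⟩] at h
    have := act_pos_of_mem_full hn hw' hp' (by omega)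
    omega
  · have h := hact p
    rw [act_zero hn hp (by omega), act_genE_genF_mul (by omega) (by omega) _ hp (by omega),
      if_pos ⟨le_rfl, hpq⟩] at h
    have := act_pos_of_mem_full hn hw hp (by omega)
    omega
  · have key : ∀ x, 1 ≤ x → x ≤ n →
        (if p ≤ x ∧ x ≤ q then act w x else 0) = if p' ≤ x ∧ x ≤ q' then act w' x else 0 := by
      intro x h₁ h₂
      have h := hact x
      rwa [act_genE_genF_mul (by omega) (by omega) _ h₁ h₂,
        act_genE_genF_mul (by omega) (by omega) _ h₁ h₂] at h
    have hdom : ∀ x, 1 ≤ x → x ≤ n → (p ≤ x ∧ x ≤ q ↔ p' ≤ x ∧ x ≤ q') := by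
      intro x h₁ h₂
      have h := key x h₁ h₂
      have := act_pos_of_mem_full hn hw h₁ h₂
      have := act_pos_of_mem_full hn hw' h₁ h₂
      split_ifs at h <;> omega
    -- Testing the four endpoints is enough to identify the two intervals.
    have d₁ := hdom p hp (by omega)
    have d₂ := hdom p' hp' (by omega)
    have d₃ := hdom q (by omega) hqn
    have d₄ := hdom q' (by omega) hqn'
    obtain rfl : p = p' := by omega
    obtain rfl : q = q' := by omega
    rw [← genE_mul_genF_mul_clamp hp hpq hqn, mul_assoc _ _ w, mul_assoc _ _ w']
    congr 1
    refine eq_of_act_eq_of_mem_full hn (mul_mem (clamp_mem_full _ _ _) hw)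
      (mul_mem (clamp_mem_full _ _ _) hw') fun x h₁ h₂ => ?_
    rw [act_mul, act_mul, act_clamp hp hpq hqn h₁ h₂]
    have h := key (min (max x p) q) (by omega) (by omega)
    rwa [if_pos (by omega), if_pos (by omega)] at h

theorem exists_eval_eq (hn : 2 ≤ n) {α : PT n} (hα : α ∈ PIOn n) : ∃ t, eval n t = α := by
  obtain ⟨p, q, hp, hqn, hdom, hstep⟩ := mem_PIOn_iff.1 hα
  by_cases hpq : p ≤ q
  -- Extend `α` to the whole chain by its values at the nearest endpoint of its domain; restricting
  -- the normal form of this extension to `[p, q]` gives `α`.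
  · let g : ℕ → ℕ := fun x => α.val (min (max x p) q)
    have hg : IsFull n g := by
      refine ⟨fun x _ _ => ?_, fun x _ _ => α.val_le _, fun x _ _ => ?_⟩
      · exact Nat.one_le_iff_ne_zero.2 ((hdom _).2 (by omega))
      · by_cases hx : p ≤ x ∧ x < q
        · have := hstep x hx.1 hx.2
          simp only [g]
          rwa [show min (max (x + 1) p) q = x + 1 by omega, show min (max x p) q = x by omega]
        · left
          simp only [g]
          rw [show min (max (x + 1) p) q = min (max x p) q by omega]
    refine ⟨genE n q * genF n p * normalForm n g, PT.ext_val fun x h₁ h₂ => ?_⟩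
    refine (act_genE_genF_mul (by omega) (by omega) _ h₁ h₂).trans ?_
    split_ifs with h
    · rw [act_normalForm hn hg h₁ h₂]
      simp only [g]
      rw [show min (max x p) q = x by omega]
    · by_contra h'
      exact h ((hdom x).1 (Ne.symm h'))
  · refine ⟨zero n, PT.ext_val fun x h₁ h₂ => (act_zero hn h₁ h₂).trans ?_⟩
    by_contra h'
    have := (hdom x).1 (Ne.symm h')
    omega

end PIOPres

theorem definedBy_PIORelations {n : ℕ} (hn : 2 ≤ n) :
    DefinedBy (PIOn n) PIOLetter.toPT (PIORelations n) := by
  refine definedBy_iff.2 ⟨fun u v h => PIORel.lift_eq h, PIOLetter.toPT_mem, fun α hα => ?_,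
    fun u v h => PIOPres.eval_injective hn h⟩
  obtain ⟨t, rfl⟩ := PIOPres.exists_eval_eq hn hα
  obtain ⟨u, rfl⟩ := PresentedMonoid.surjective_mk t
  exact ⟨u, rfl⟩

/-! ### From a presentation of `PIOn n` to a presentation of `PIMn n` -/

section Extension

variable {n : ℕ}

/-- Words over the letters `a_i, b_i, e_i, f_j`, read in the larger alphabet. -/
abbrev inclWord (n : ℕ) : FreeMonoid (PIOLetter n) →* FreeMonoid (PIMLetter n) :=
  FreeMonoid.map PIMLetter.of

theorem lift_inclWord (u : FreeMonoid (PIOLetter n)) :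
    FreeMonoid.lift PIMLetter.toPT (inclWord n u) = FreeMonoid.lift PIOLetter.toPT u := by
  have : (FreeMonoid.lift PIMLetter.toPT).comp (inclWord n) = FreeMonoid.lift PIOLetter.toPT :=
    FreeMonoid.hom_eq fun x => by simp [PIMLetter.toPT]
  exact DFunLike.congr_fun this u

theorem val_lift_wa_pow (i : ℕ) (hi : 1 ≤ i ∧ i < n) (k : ℕ) {x : ℕ} (h₁ : 1 ≤ x)
    (h₂ : x ≤ n) : (FreeMonoid.lift PIOLetter.toPT (wa i hi ^ k)).val x =
      min x (max (x - k) i) := by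
  rw [← PIOPres.act_genA_pow hi.1 hi.2 k h₁ h₂, ← PIOPres.mk_wa i hi, ← map_pow]
  rfl

theorem val_lift_wb_pow (i : ℕ) (hi : 1 ≤ i ∧ i < n) (k : ℕ) {x : ℕ} (h₁ : 1 ≤ x)
    (h₂ : x ≤ n) : (FreeMonoid.lift PIOLetter.toPT (wb i hi ^ k)).val x =
      max x (min (x + k) (i + 1)) := by
  rw [← PIOPres.act_genB_pow hi.1 hi.2 k h₁ h₂, ← PIOPres.mk_wb i hi, ← map_pow]
  rfl

theorem NRel.lift_eq {u v : FreeMonoid (PIMLetter n)} (h : NRel n u v) :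
    FreeMonoid.lift PIMLetter.toPT u = FreeMonoid.lift PIMLetter.toPT v := by
  cases h with
  | N0 => simpa using h_mul_h
  | N1 i hi hin =>
    refine PT.ext_val fun x h₁ h₂ => ?_
    simp only [map_mul, FreeMonoid.lift_eval_of, PT.val_mul]
    rw [PIMLetter.val_h h₁ h₂]
    simp only [PIMLetter.toPT]
    rw [PIOLetter.val_a i ⟨hi, hin⟩ (by omega) (by omega), PIOLetter.val_b _ _ h₁ h₂]
    refine Eq.trans ?_ (PIMLetter.val_h (by split_ifs <;> omega) (by split_ifs <;> omega)).symm
    split_ifs <;> omega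
  | N1' i hi hin =>
    refine PT.ext_val fun x h₁ h₂ => ?_
    simp only [map_mul, FreeMonoid.lift_eval_of, PT.val_mul]
    rw [PIMLetter.val_h h₁ h₂]
    change (PIOLetter.e i ⟨hi, hin⟩).toPT.val _ = (PIMLetter.h : PIMLetter n).toPT.val
      ((PIOLetter.f (n - i + 1) (by omega)).toPT.val x)
    rw [PIOLetter.val_e, PIOLetter.val_f _ _ h₂]
    by_cases hx : n - i + 1 ≤ x
    · rw [if_pos hx, if_pos (by omega), PIMLetter.val_h h₁ h₂]
    · rw [if_neg hx, if_neg (by omega), PT.val_zero]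
  | N2 hn =>
    refine PT.ext_val fun x h₁ h₂ => ?_
    -- Both sides of `N₂` are the constant map with value `n`.
    have hA := lift_inclWord (wa 1 (by omega : 1 ≤ 1 ∧ 1 < n) ^ (n - 1))
    have hB := lift_inclWord (wb (n - 1) (by omega : 1 ≤ n - 1 ∧ n - 1 < n) ^ (n - 1))
    rw [map_pow] at hA hB
    change FreeMonoid.lift PIMLetter.toPT (FreeMonoid.of _ ^ (n - 1)) = _ at hA
    change FreeMonoid.lift PIMLetter.toPT (FreeMonoid.of _ ^ (n - 1)) = _ at hB
    rw [map_mul, hA, hB, PT.val_mul, val_lift_wa_pow _ _ _ h₁ h₂, val_lift_wb_pow _ _ _ h₁ h₂,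
      FreeMonoid.lift_eval_of, PIMLetter.val_h (by omega) (by omega)]
    omega

/-- An order-preserving transformation that stays order-preserving after reflection is constant
on its domain. -/
theorem exists_val_eq_of_mul_h_mem {α : PT n} (hn : 2 ≤ n) (hα : α ∈ PIOn n)
    (hαh : α * (PIMLetter.h : PIMLetter n).toPT ∈ PIOn n) :
    ∃ d, 1 ≤ d ∧ d ≤ n ∧ ∀ x, α.val x = 0 ∨ α.val x = d := by
  by_cases hne : ∃ x, α.val x ≠ 0
  · obtain ⟨x, hx⟩ := hne
    have hmem : ∀ y, α.val y ≠ 0 → 1 ≤ y ∧ y ≤ n := fun y hy => by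
      by_contra h
      exact hy (α.val_of_not_mem h)
    have hle : ∀ y z, α.val y ≠ 0 → α.val z ≠ 0 → y ≤ z → α.val y = α.val z := by
      intro y z hy hz hyz
      have hby := α.val_le y
      have hbz := α.val_le z
      have e₁ : α ⟨y, hmem y hy⟩ = some ⟨α.val y, by omega⟩ := PT.eq_some_iff.2 rfl
      have e₂ : α ⟨z, hmem z hz⟩ = some ⟨α.val z, by omega⟩ := PT.eq_some_iff.2 rfl
      have e₃ : (α * (PIMLetter.h : PIMLetter n).toPT) ⟨y, hmem y hy⟩ =
          some ⟨n + 1 - α.val y, by omega⟩ := by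
        rw [PT.eq_some_iff, PT.val_mul, PIMLetter.val_h (by omega) hby]
      have e₄ : (α * (PIMLetter.h : PIMLetter n).toPT) ⟨z, hmem z hz⟩ =
          some ⟨n + 1 - α.val z, by omega⟩ := by
        rw [PT.eq_some_iff, PT.val_mul, PIMLetter.val_h (by omega) hbz]
      have l₁ := Subtype.mk_le_mk.1 (hα.1.le e₁ e₂ (Subtype.mk_le_mk.2 hyz))
      have l₂ := Subtype.mk_le_mk.1 (hαh.1.le e₃ e₄ (Subtype.mk_le_mk.2 hyz))
      omega
    refine ⟨α.val x, by omega, α.val_le x, fun y => ?_⟩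
    by_cases hy : α.val y = 0
    · exact Or.inl hy
    · right
      rcases le_total x y with h | h
      · exact (hle x y hx hy h).symm
      · exact hle y x hy hx h
  · push Not at hne
    -- For the empty transformation any point can serve as `d`.
    exact ⟨1, le_rfl, by omega, fun x => Or.inl (hne x)⟩

/-! ### Calculation in the monoid presented by `RHat n R'`. -/

variable {R' : Relations (PIOLetter n)}

/-- The class of a word in the monoid presented by `RHat n R'`. -/
abbrev mkHat (R' : Relations (PIOLetter n)) :
    FreeMonoid (PIMLetter n) →* PresentedMonoid (fun u v => (u, v) ∈ RHat n R') :=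
  PresentedMonoid.mk _

theorem mkHat_eq_of_NRel {u v : FreeMonoid (PIMLetter n)} (h : NRel n u v) :
    mkHat R' u = mkHat R' v :=
  PresentedMonoid.mk_eq_mk_of_rel (rels := fun u v => (u, v) ∈ RHat n R') (Or.inr h)

/-- The class of `h`. -/
abbrev hHat (R' : Relations (PIOLetter n)) : PresentedMonoid (fun u v => (u, v) ∈ RHat n R') :=
  mkHat R' (FreeMonoid.of .h)

theorem hHat_mul_hHat : hHat R' * hHat R' = 1 := by
  rw [← map_mul, mkHat_eq_of_NRel NRel.N0, map_one]

theorem hHat_mul_wa (i : ℕ) (hi : 1 ≤ i ∧ i < n) :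
    hHat R' * mkHat R' (inclWord n (wa i)) =
      mkHat R' (inclWord n (wb (n - i))) * hHat R' := by
  have h := mkHat_eq_of_NRel (R' := R') (NRel.N1 i hi.1 hi.2)
  rwa [map_mul, map_mul] at h

theorem hHat_mul_we (i : ℕ) (hi : 1 ≤ i ∧ i < n) :
    hHat R' * mkHat R' (inclWord n (we i)) =
      mkHat R' (inclWord n (wf (n - i + 1))) * hHat R' := by
  have h := mkHat_eq_of_NRel (R' := R') (NRel.N1' i hi.1 hi.2)
  rwa [map_mul, map_mul] at h

/-- Since `h` is an involution, conjugation by it is symmetric; this yields the rules for `h b_i`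
and `h f_j` from those for `h a_i` and `h e_i`. -/
theorem hHat_mul_of_mul_hHat {s t : PresentedMonoid (fun u v => (u, v) ∈ RHat n R')}
    (h : hHat R' * s = t * hHat R') : hHat R' * t = s * hHat R' := by
  calc hHat R' * t = hHat R' * (t * hHat R') * hHat R' := by
        rw [mul_assoc, mul_assoc, hHat_mul_hHat, mul_one]
    _ = s * hHat R' := by rw [← h, ← mul_assoc, hHat_mul_hHat, one_mul]

theorem exists_hHat_mul_of (x : PIOLetter n) : ∃ y : PIOLetter n,
    hHat R' * mkHat R' (inclWord n (FreeMonoid.of x)) =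
      mkHat R' (inclWord n (FreeMonoid.of y)) * hHat R' := by
  cases x with
  | a i hi => exact ⟨.b (n - i) (by omega), hHat_mul_wa i hi⟩
  | b i hi =>
    refine ⟨.a (n - i) (by omega), hHat_mul_of_mul_hHat ?_⟩
    have h := hHat_mul_wa (R' := R') (n - i) (by omega)
    simp only [show n - (n - i) = i by omega] at h
    exact h
  | e i hi => exact ⟨.f (n - i + 1) (by omega), hHat_mul_we i hi⟩
  | f j hj =>
    refine ⟨.e (n - j + 1) (by omega), hHat_mul_of_mul_hHat ?_⟩
    have h := hHat_mul_we (R' := R') (n - j + 1) (by omega)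
    simp only [show n - (n - j + 1) + 1 = j by omega] at h
    exact h

theorem exists_hHat_mul (u : FreeMonoid (PIOLetter n)) : ∃ v : FreeMonoid (PIOLetter n),
    hHat R' * mkHat R' (inclWord n u) = mkHat R' (inclWord n v) * hHat R' := by
  induction u with
  | one => exact ⟨1, by simp⟩
  | of x => exact (exists_hHat_mul_of x).imp' FreeMonoid.of fun _ h => h
  | mul u u' ih ih' =>
    obtain ⟨v, hv⟩ := ih
    obtain ⟨v', hv'⟩ := ih'
    refine ⟨v * v', ?_⟩
    simp only [map_mul] at *
    rw [← mul_assoc, hv, mul_assoc, hv', mul_assoc]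

/-- Every `h` can be pushed to the right end, where pairs cancel. -/
theorem exists_mkHat_eq (w : FreeMonoid (PIMLetter n)) : ∃ u : FreeMonoid (PIOLetter n),
    mkHat R' w = mkHat R' (inclWord n u) ∨ mkHat R' w = mkHat R' (inclWord n u) * hHat R' := by
  induction w using FreeMonoid.inductionOn' with
  | one => exact ⟨1, Or.inl (by simp)⟩
  | of_mul x w ih =>
    obtain ⟨u, hu⟩ := ih
    cases x with
    | of x =>
      refine ⟨FreeMonoid.of x * u, hu.imp ?_ ?_⟩ <;> intro h <;>
        simp only [map_mul, h, FreeMonoid.map_of, mul_assoc]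
    | h =>
      obtain ⟨v, hv⟩ := exists_hHat_mul (R' := R') u
      refine ⟨v, hu.symm.imp ?_ ?_⟩ <;> intro h <;> rw [map_mul, h]
      · rw [← mul_assoc, hv, mul_assoc, hHat_mul_hHat, mul_one]
      · exact hv

/-- The relations `R'` hold in the larger presented monoid, so everything they imply does too, and
they imply every equality valid in `PIOn n`. -/
theorem mkHat_inclWord_eq (hR : DefinedBy (PIOn n) PIOLetter.toPT R')
    {u v : FreeMonoid (PIOLetter n)}
    (h : FreeMonoid.lift PIOLetter.toPT u = FreeMonoid.lift PIOLetter.toPT v) :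
    mkHat R' (inclWord n u) = mkHat R' (inclWord n v) := by
  have hlift : FreeMonoid.lift (fun x => mkHat R' (FreeMonoid.of (PIMLetter.of x))) =
      (mkHat R').comp (inclWord n) := FreeMonoid.hom_eq fun x => by simp
  let F : PresentedMonoid (fun u v => (u, v) ∈ R') →*
      PresentedMonoid (fun u v => (u, v) ∈ RHat n R') :=
    PresentedMonoid.lift (fun x => mkHat R' (FreeMonoid.of (PIMLetter.of x))) fun u v huv => by
      rw [hlift]
      exact PresentedMonoid.mk_eq_mk_of_rel (rels := fun u v => (u, v) ∈ RHat n R')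
        (Or.inl ⟨(u, v), huv, rfl⟩)
  have hF : ∀ w, F (PresentedMonoid.mk _ w) = mkHat R' (inclWord n w) := fun w =>
    DFunLike.congr_fun hlift w
  rw [← hF, ← hF, (definedBy_iff.1 hR).2.2.2 u v h]

theorem wb_last_pow_mul_hHat (hn : 2 ≤ n) (k : ℕ) :
    mkHat R' (inclWord n (wb (n - 1) ^ k)) * hHat R' =
      hHat R' * mkHat R' (inclWord n (wa 1 ^ k)) := by
  have h : SemiconjBy (hHat R') (mkHat R' (inclWord n (wa 1)))
      (mkHat R' (inclWord n (wb (n - 1)))) :=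
    hHat_mul_wa 1 (by omega)
  simpa only [map_pow] using (h.pow_right k).eq.symm

theorem wa_one_pow_mul_hHat (hn : 2 ≤ n) :
    mkHat R' (inclWord n (wa 1 ^ (n - 1))) * hHat R' =
      mkHat R' (inclWord n (wb (n - 1) ^ (n - 1))) := by
  have h := mkHat_eq_of_NRel (R' := R') (NRel.N2 hn)
  rw [map_mul] at h
  rw [map_pow (inclWord n), map_pow (inclWord n)]
  exact h

theorem definedBy_RHat (hn : 2 ≤ n) (hR : DefinedBy (PIOn n) PIOLetter.toPT R') :
    DefinedBy (PIMn n) PIMLetter.toPT (RHat n R') := by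
  obtain ⟨hrel, hmem, hsurj, -⟩ := definedBy_iff.1 hR
  have hsound : ∀ u v, (u, v) ∈ RHat n R' →
      FreeMonoid.lift PIMLetter.toPT u = FreeMonoid.lift PIMLetter.toPT v := by
    rintro u v (⟨⟨u, v⟩, huv, h⟩ | h)
    · obtain ⟨rfl, rfl⟩ := Prod.mk.inj h
      rw [lift_inclWord, lift_inclWord, hrel u v huv]
    · exact NRel.lift_eq h
  have hlift : ∀ {u v}, mkHat R' u = mkHat R' v →
      FreeMonoid.lift PIMLetter.toPT u = FreeMonoid.lift PIMLetter.toPT v := fun {u v} h =>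
    congrArg (PresentedMonoid.lift PIMLetter.toPT hsound) h
  have hmemPIOn : ∀ u, FreeMonoid.lift PIOLetter.toPT u ∈ PIOn n := by
    intro u
    induction u with
    | one => rw [map_one]; exact one_mem _
    | of x => rw [FreeMonoid.lift_eval_of]; exact hmem x
    | mul u v hu hv => rw [map_mul]; exact mul_mem hu hv
  -- The critical comparison, between a word without `h` and one ending in `h`; this is where `N₂`
  -- enters.
  have hmixed : ∀ u v, FreeMonoid.lift PIOLetter.toPT u =
      FreeMonoid.lift PIOLetter.toPT v * (PIMLetter.h : PIMLetter n).toPT →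
      mkHat R' (inclWord n u) = mkHat R' (inclWord n v) * hHat R' := by
    intro u v huv
    obtain ⟨d, hd, hdn, hval⟩ := exists_val_eq_of_mul_h_mem hn (hmemPIOn v) (huv ▸ hmemPIOn u)
    -- On its image `{d}` the map `v` may be followed by the constant map `1`, then by `d - 1` steps
    -- up that lead back to `d`.
    have hv : mkHat R' (inclWord n v) =
        mkHat R' (inclWord n (v * wa 1 ^ (n - 1) * wb (n - 1) ^ (d - 1))) := by
      refine mkHat_inclWord_eq hR (PT.ext_val fun x _ _ => ?_)
      rw [map_mul, map_mul, PT.val_mul, PT.val_mul]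
      rcases hval x with h | h
      · rw [h, PT.val_zero, PT.val_zero]
      · rw [h, val_lift_wa_pow _ _ _ hd hdn, val_lift_wb_pow _ _ _ (by omega) (by omega)]
        omega
    -- Passing `h` to the left turns `b_{n-1}^{d-1}` into `a_1^{d-1}`; it then meets `a_1^{n-1}`,
    -- and `N₂` eliminates it.
    have key : mkHat R' (inclWord n v) * hHat R' =
        mkHat R' (inclWord n (v * wb (n - 1) ^ (n - 1) * wa 1 ^ (d - 1))) := by
      rw [hv]
      simp only [map_mul (inclWord n), map_mul (mkHat R')]
      rw [mul_assoc, wb_last_pow_mul_hHat hn, ← mul_assoc, mul_assoc (mkHat R' _),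
        wa_one_pow_mul_hHat hn]
    rw [key]
    refine mkHat_inclWord_eq hR ?_
    -- Evaluating `key` shows that the new word without `h` denotes the same map as `u`, so the
    -- comparison can be made in `PIOn n`.
    have h := hlift (u := inclWord n v * FreeMonoid.of .h) ((map_mul (mkHat R') _ _).trans key)
    rw [lift_inclWord, map_mul, lift_inclWord, FreeMonoid.lift_eval_of] at h
    rw [huv, h]
  have hcancel : ∀ {α β : PT n}, α * (PIMLetter.h : PIMLetter n).toPT =
      β * (PIMLetter.h : PIMLetter n).toPT → α = β := fun {α β} h => by
    rw [← mul_one α, ← h_mul_h, ← mul_assoc, h, mul_assoc, h_mul_h, mul_one]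
  refine definedBy_iff.2 ⟨hsound, PIMLetter.toPT_mem, ?_, ?_⟩
  · rintro α ⟨hα | hα, hi⟩
    · obtain ⟨u, rfl⟩ := hsurj α ⟨hα, hi⟩
      exact ⟨inclWord n u, lift_inclWord u⟩
    · obtain ⟨u, hu⟩ := hsurj _ (mul_h_mem_PIOn hα hi)
      refine ⟨inclWord n u * FreeMonoid.of .h, ?_⟩
      rw [map_mul, lift_inclWord, hu, FreeMonoid.lift_eval_of, mul_assoc, h_mul_h, mul_one]
  · intro w w' hww
    change mkHat R' w = mkHat R' w'
    obtain ⟨u, hu⟩ := exists_mkHat_eq (R' := R') w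
    obtain ⟨v, hv⟩ := exists_mkHat_eq (R' := R') w'
    rw [← map_mul] at hu hv
    rcases hu with hu | hu <;> rcases hv with hv | hv <;> rw [hu, hv] <;>
      rw [hlift hu, hlift hv] at hww <;>
      simp only [map_mul, lift_inclWord, FreeMonoid.lift_eval_of] at hww ⊢
    · exact mkHat_inclWord_eq hR hww
    · exact hmixed u v hww
    · exact (hmixed v u hww.symm).symm
    · rw [mkHat_inclWord_eq hR (hcancel hww)]

end Extension

/-! ### Counting letters -/

section Letters

variable {n : ℕ}

/-- Each of the four kinds of letters is indexed by `n - 1` numbers. -/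
def PIOLetter.equivSum (n : ℕ) :
    PIOLetter n ≃ (Fin (n - 1) ⊕ Fin (n - 1)) ⊕ (Fin (n - 1) ⊕ Fin (n - 1)) where
  toFun
    | .a i hi => .inl (.inl ⟨i - 1, by omega⟩)
    | .b i hi => .inl (.inr ⟨i - 1, by omega⟩)
    | .e i hi => .inr (.inl ⟨i - 1, by omega⟩)
    | .f j hj => .inr (.inr ⟨j - 2, by omega⟩)
  invFun
    | .inl (.inl i) => .a (i + 1) (by omega)
    | .inl (.inr i) => .b (i + 1) (by omega)
    | .inr (.inl i) => .e (i + 1) (by omega)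
    | .inr (.inr j) => .f (j + 2) (by omega)
  left_inv x := by
    cases x <;> simp only [PIOLetter.a.injEq, PIOLetter.b.injEq, PIOLetter.e.injEq,
      PIOLetter.f.injEq] <;> omega
  right_inv x := by
    rcases x with (i | i) | (i | i) <;> simp

/-- The larger alphabet has one more letter. -/
def PIMLetter.equivOption (n : ℕ) : PIMLetter n ≃ Option (PIOLetter n) where
  toFun
    | .of x => some x
    | .h => none
  invFun
    | some x => .of x
    | none => .h
  left_inv x := by cases x <;> rfl
  right_inv x := by cases x <;> rfl

theorem PIMLetter.nat_card (hn : 2 ≤ n) : Nat.card (PIMLetter n) = 4 * n - 3 := by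
  rw [Nat.card_congr ((PIMLetter.equivOption n).trans (PIOLetter.equivSum n).optionCongr)]
  simp only [Nat.card_eq_fintype_card, Fintype.card_option, Fintype.card_sum, Fintype.card_fin]
  omega

/-- The images of `1` and `n` (with `0` for undefined) tell the kinds apart: `(1, n-1)` for `a`,
`(2, n)` for `b`, `(1, 0)` for `e`, `(0, n)` for `f`, `(n, 1)` for `h`. Within a kind, the points
where the behaviour changes give the index. -/
theorem PIMLetter.toPT_injective (hn : 2 ≤ n) :
    Function.Injective (PIMLetter.toPT (n := n)) := by
  intro x y hxy
  have hval : ∀ k, x.toPT.val k = y.toPT.val k := fun k => by rw [hxy]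
  clear hxy
  have v₁ := hval 1
  have v₂ := hval n
  rcases x with ⟨⟨i, hi⟩ | ⟨i, hi⟩ | ⟨i, hi⟩ | ⟨i, hi⟩⟩ | _ <;>
  rcases y with ⟨⟨j, hj⟩ | ⟨j, hj⟩ | ⟨j, hj⟩ | ⟨j, hj⟩⟩ | _ <;>
  simp (disch := omega) only [PIMLetter.toPT.eq_1, PIMLetter.val_h, PIOLetter.val_a,
    PIOLetter.val_b, PIOLetter.val_e, PIOLetter.val_f] at v₁ v₂ <;>
  first
  | rfl
  | (exfalso; split_ifs at v₁ v₂ <;> omega)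
  | skip
  · have h₁ := hval (i + 1)
    have h₂ := hval (j + 1)
    simp (disch := omega) only [PIMLetter.toPT.eq_1, PIOLetter.val_a] at h₁ h₂
    obtain rfl : i = j := by split_ifs at h₁ h₂ <;> omega
    rfl
  · have h₁ := hval i
    have h₂ := hval j
    simp (disch := omega) only [PIMLetter.toPT.eq_1, PIOLetter.val_b] at h₁ h₂
    obtain rfl : i = j := by split_ifs at h₁ h₂ <;> omega
    rfl
  · have h₁ := hval i
    have h₂ := hval j
    simp (disch := omega) only [PIMLetter.toPT.eq_1, PIOLetter.val_e] at h₁ h₂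
    obtain rfl : i = j := by split_ifs at h₁ h₂ <;> omega
    rfl
  · have h₁ := hval i
    have h₂ := hval j
    simp (disch := omega) only [PIMLetter.toPT.eq_1, PIOLetter.val_f] at h₁ h₂
    obtain rfl : i = j := by split_ifs at h₁ h₂ <;> omega
    rfl

end Letters

/-! ### Counting relations -/

section Relations

variable {n : ℕ}

theorem encard_NRel (hn : 2 ≤ n) :
    {p : FreeMonoid (PIMLetter n) × FreeMonoid (PIMLetter n) | NRel n p.1 p.2}.encard =
      2 * n := by
  let L : Bool ⊕ (Bool × Fin (n - 1)) → FreeMonoid (PIMLetter n) × FreeMonoid (PIMLetter n)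
    | .inl false => (FreeMonoid.of .h * FreeMonoid.of .h, 1)
    | .inl true => (FreeMonoid.of (.of (.a 1 (by omega))) ^ (n - 1) * FreeMonoid.of .h,
        FreeMonoid.of (.of (.b (n - 1) (by omega))) ^ (n - 1))
    | .inr (false, i) => (FreeMonoid.of .h * FreeMonoid.of (.of (.a (i + 1) (by omega))),
        FreeMonoid.of (.of (.b (n - (i + 1)) (by omega))) * FreeMonoid.of .h)
    | .inr (true, i) => (FreeMonoid.of .h * FreeMonoid.of (.of (.e (i + 1) (by omega))),
        FreeMonoid.of (.of (.f (n - (i + 1) + 1) (by omega))) * FreeMonoid.of .h)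
  have hrange : {p : FreeMonoid (PIMLetter n) × FreeMonoid (PIMLetter n) | NRel n p.1 p.2} =
      Set.range L := by
    ext ⟨u, v⟩
    constructor
    · intro h
      change NRel n u v at h
      cases h with
      | N0 => exact ⟨.inl false, rfl⟩
      | N1 i hi hin =>
        obtain ⟨i, rfl⟩ : ∃ k, i = k + 1 := ⟨i - 1, by omega⟩
        exact ⟨.inr (false, ⟨i, by omega⟩), rfl⟩
      | N1' i hi hin =>
        obtain ⟨i, rfl⟩ : ∃ k, i = k + 1 := ⟨i - 1, by omega⟩
        exact ⟨.inr (true, ⟨i, by omega⟩), rfl⟩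
      | N2 => exact ⟨.inl true, rfl⟩
    · rintro ⟨(_ | _) | ⟨_ | _, i⟩, h⟩ <;> rw [← h]
      · exact NRel.N0
      · exact NRel.N2 hn
      · exact NRel.N1 (i + 1) (by omega) (by omega)
      · exact NRel.N1' (i + 1) (by omega) (by omega)
  have hinj : Function.Injective L := by
    -- The first two letters of a left-hand side already determine the relation.
    let decode : List (PIMLetter n) → ℕ × ℕ
      | .h :: .h :: _ => (0, 0)
      | .h :: .of (.a i _) :: _ => (1, i)
      | .h :: .of (.e i _) :: _ => (2, i)
      | _ => (3, 0)
    have hdecode : ∀ s, decode (L s).1.toList = match s with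
        | .inl false => (0, 0)
        | .inl true => (3, 0)
        | .inr (false, i) => (1, i.1 + 1)
        | .inr (true, i) => (2, i.1 + 1) := by
      rintro ((_ | _) | ⟨_ | _, i⟩)
      · rfl
      -- As `n - 1` is positive, the left side of `N₂` visibly starts with `a_1`, not with `h`.
      · obtain ⟨m, hm⟩ : ∃ m, n - 1 = m + 1 := ⟨n - 2, by omega⟩
        simp only [L, hm, pow_succ', FreeMonoid.toList_mul, FreeMonoid.toList_of]
        rfl
      · rfl
      · rfl
    intro s t hst
    have h := congrArg (fun p => decode p.1.toList) hst
    simp only [hdecode] at h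
    rcases s with (_ | _) | ⟨_ | _, i⟩ <;> rcases t with (_ | _) | ⟨_ | _, j⟩ <;>
      simp_all [Fin.ext_iff]
  rw [hrange, ← Set.image_univ, hinj.encard_image, Set.encard_univ, ENat.card_eq_coe_fintype_card]
  simp only [Fintype.card_sum, Fintype.card_prod, Fintype.card_bool, Fintype.card_fin]
  norm_cast
  omega

theorem encard_RHat (hn : 2 ≤ n) (R' : Relations (PIOLetter n)) :
    (RHat n R').encard = R'.encard + 2 * n := by
  have hinj : Function.Injective (FreeMonoid.map (PIMLetter.of (n := n))) :=
    List.map_injective_iff.2 fun x y h => by simpa using h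
  rw [RHat, Set.encard_union_eq, (hinj.prodMap hinj).encard_image, encard_NRel hn]
  rw [Set.disjoint_left]
  rintro _ ⟨⟨u, v⟩, -, rfl⟩ h
  -- A multiplicative detector of `h`: it is `1` on words without `h`, and `0` on the left sides of
  -- the `N`-relations, all of which contain `h`.
  let χ : FreeMonoid (PIMLetter n) →* ℕ :=
    FreeMonoid.lift fun x => match x with
      | .of _ => 1
      | .h => 0
  have h₁ : ∀ u, χ (FreeMonoid.map PIMLetter.of u) = 1 := by
    intro u
    induction u with
    | one => simp
    | of x => simp [χ]
    | mul u v hu hv => rw [map_mul, map_mul, hu, hv]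
  have h₀ : ∀ {u v}, NRel n u v → χ u = 0 := by
    intro u v h
    cases h <;> simp [χ]
  exact one_ne_zero ((h₁ u).symm.trans (h₀ h))

end Relations

/-! ### The number of relations in `PIORelations n` -/

/-- The triangle of all pairs `(i, j)` with `lo ≤ i ≤ j < lo + m`. -/
def triangle (lo m : ℕ) : Finset (ℕ × ℕ) :=
  ((Finset.range m).sigma fun j => Finset.range (j + 1)).image fun s => (lo + s.2, lo + s.1)

theorem mem_triangle {lo m i j : ℕ} :
    (i, j) ∈ triangle lo m ↔ lo ≤ i ∧ i ≤ j ∧ j < lo + m := by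
  simp only [triangle, Finset.mem_image, Finset.mem_sigma, Finset.mem_range, Prod.mk.injEq,
    Sigma.exists]
  constructor
  · rintro ⟨a, b, h, rfl, rfl⟩
    omega
  · intro h
    exact ⟨j - lo, i - lo, by omega, by omega, by omega⟩

theorem two_mul_card_triangle (lo m : ℕ) : 2 * (triangle lo m).card = m * (m + 1) := by
  rw [triangle, Finset.card_image_of_injective, Finset.card_sigma]
  · simp only [Finset.card_range]
    induction m with
    | zero => rfl
    | succ m ih => rw [Finset.sum_range_succ, mul_add, ih]; ring
  · rintro ⟨a, b⟩ ⟨a', b'⟩ h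
    simp only [Prod.mk.injEq, Nat.add_left_cancel_iff] at h
    obtain ⟨rfl, rfl⟩ := h
    rfl

/-- The pairs `(i, 0)` with `lo ≤ i < lo + m`. -/
def column (lo m : ℕ) : Finset (ℕ × ℕ) := Finset.Ico lo (lo + m) ×ˢ {0}

theorem mem_column {lo m i j : ℕ} : (i, j) ∈ column lo m ↔ (lo ≤ i ∧ i < lo + m) ∧ j = 0 := by
  simp [column, eq_comm]

theorem card_column (lo m : ℕ) : (column lo m).card = m := by
  simp [column]

namespace PIORel

/-- The families of relations in `PIORel`. -/
inductive Family : Type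
  | aa | aa_last | bb | bb_first | ab | ab_last | ba_first
  | ee | ee_succ | ff | ff_succ | fe | ef_zero
  | ea | fb | ae | ae_last | ae_pred | bf | bf_first | bf_succ | af | af_zero | be | be_zero
  | a_zero | b_zero

/-- The set of all families. -/
def Family.all : Finset Family where
  val := ↑([.aa, .aa_last, .bb, .bb_first, .ab, .ab_last, .ba_first, .ee, .ee_succ, .ff, .ff_succ,
    .fe, .ef_zero, .ea, .fb, .ae, .ae_last, .ae_pred, .bf, .bf_first, .bf_succ, .af, .af_zero,
    .be, .be_zero, .a_zero, .b_zero] : List Family)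
  nodup := by simp

theorem Family.mem_all (k : Family) : k ∈ Family.all := by
  cases k <;> simp [Family.all]

/-- The pairs of numbers that index the members of a family. -/
def Family.index (n : ℕ) : Family → Finset (ℕ × ℕ)
  | .aa | .ab | .ae | .af => triangle 1 (n - 2)
  | .bb | .be | .bf => triangle 2 (n - 2)
  | .ee | .fe => triangle 1 (n - 1)
  | .ff => triangle 2 (n - 1)
  | .aa_last | .bb_first | .ab_last | .ba_first | .ef_zero | .ea | .fb | .ae_last | .bf_first
  | .af_zero | .be_zero => column 1 (n - 1)
  | .ee_succ | .bf_succ => column 1 (n - 2)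
  | .ff_succ | .ae_pred => column 2 (n - 2)
  | .a_zero | .b_zero => column 0 1

variable {n : ℕ}

/-- The word `a_i`, extended by the empty word. -/
def wordA (n i : ℕ) : FreeMonoid (PIOLetter n) := if h : 1 ≤ i ∧ i < n then wa i h else 1

/-- The word `b_i`, extended by the empty word. -/
def wordB (n i : ℕ) : FreeMonoid (PIOLetter n) := if h : 1 ≤ i ∧ i < n then wb i h else 1

/-- The word `e_i`, extended by the empty word. -/
def wordE (n i : ℕ) : FreeMonoid (PIOLetter n) := if h : 1 ≤ i ∧ i < n then we i h else 1

/-- The word `f_j`, extended by the empty word. -/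
def wordF (n j : ℕ) : FreeMonoid (PIOLetter n) := if h : 2 ≤ j ∧ j ≤ n then wf j h else 1

theorem wordA_eq {i : ℕ} (h : 1 ≤ i ∧ i < n) : wordA n i = wa i h := dif_pos h

theorem wordB_eq {i : ℕ} (h : 1 ≤ i ∧ i < n) : wordB n i = wb i h := dif_pos h

theorem wordE_eq {i : ℕ} (h : 1 ≤ i ∧ i < n) : wordE n i = we i h := dif_pos h

theorem wordF_eq {j : ℕ} (h : 2 ≤ j ∧ j ≤ n) : wordF n j = wf j h := dif_pos h

/-- The member of a family with a given index. -/
def Family.rel (n : ℕ) : Family → ℕ → ℕ → FreeMonoid (PIOLetter n) × FreeMonoid (PIOLetter n)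
  | .aa, i, j => (wordA n i * wordA n j, wordA n (j + 1) * wordA n i)
  | .aa_last, i, _ => (wordA n i * wordA n (n - 1), wordA n i)
  | .bb, j, i => (wordB n i * wordB n j, wordB n (j - 1) * wordB n i)
  | .bb_first, i, _ => (wordB n i * wordB n 1, wordB n i)
  | .ab, i, j => (wordA n i * wordB n j, wordB n (j + 1) * wordA n (i + 1))
  | .ab_last, i, _ => (wordA n i * wordB n (n - 1), wordB n i)
  | .ba_first, i, _ => (wordB n i * wordA n 1, wordA n i)
  | .ee, i, j => (wordE n i * wordE n j, wordE n i)
  | .ee_succ, i, _ => (wordE n (i + 1) * wordE n i, wordE n i)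
  | .ff, i, j => (wordF n j * wordF n i, wordF n j)
  | .ff_succ, i, _ => (wordF n i * wordF n (i + 1), wordF n (i + 1))
  | .fe, j, i => (wordF n (j + 1) * wordE n i, wordE n i * wordF n (j + 1))
  | .ef_zero, i, _ => (wordE n i * wordF n (i + 1), wordA n i * wordF n n)
  | .ea, i, _ => (wordE n i * wordA n i, wordE n i)
  | .fb, i, _ => (wordF n (i + 1) * wordB n i, wordF n (i + 1))
  | .ae, i, j => (wordA n i * wordE n j, wordE n (j + 1) * wordA n i)
  | .ae_last, i, _ => (wordA n i * wordE n (n - 1), wordA n i)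
  | .ae_pred, i, _ => (wordA n i * wordE n (i - 1), wordE n (i - 1))
  | .bf, j, i => (wordB n i * wordF n (j + 1), wordF n (j + 1 - 1) * wordB n i)
  | .bf_first, i, _ => (wordB n i * wordF n 2, wordB n i)
  | .bf_succ, i, _ => (wordB n i * wordF n (i + 2), wordF n (i + 2))
  | .af, i, j => (wordA n i * wordF n (j + 1), wordF n (j + 1 + 1) * wordA n i)
  | .af_zero, i, _ => (wordA n i * wordF n n, wordF n n * wordE n 1)
  | .be, j, i => (wordB n i * wordE n j, wordE n (j - 1) * wordB n i)
  | .be_zero, i, _ => (wordB n i * wordE n 1, wordF n n * wordE n 1)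
  | .a_zero, _, _ => (wordA n 1 * (wordF n n * wordE n 1), wordF n n * wordE n 1)
  | .b_zero, _, _ => (wordB n (n - 1) * (wordF n n * wordE n 1), wordF n n * wordE n 1)

/-- The family and the index of a relation, read off from its left-hand side. -/
def decode (n : ℕ) : List (PIOLetter n) → Σ _ : Family, ℕ × ℕ
  | [.a i _, .a j _] => if j + 1 < n then ⟨.aa, i, j⟩ else ⟨.aa_last, i, 0⟩
  | [.b i _, .b j _] => if 2 ≤ j then ⟨.bb, j, i⟩ else ⟨.bb_first, i, 0⟩
  | [.a i _, .b j _] => if j + 1 < n then ⟨.ab, i, j⟩ else ⟨.ab_last, i, 0⟩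
  | [.b i _, .a _ _] => ⟨.ba_first, i, 0⟩
  | [.e i _, .e j _] => if i ≤ j then ⟨.ee, i, j⟩ else ⟨.ee_succ, j, 0⟩
  | [.f j _, .f i _] => if i ≤ j then ⟨.ff, i, j⟩ else ⟨.ff_succ, j, 0⟩
  | [.f j _, .e i _] => ⟨.fe, j - 1, i⟩
  | [.e i _, .f _ _] => ⟨.ef_zero, i, 0⟩
  | [.e i _, .a _ _] => ⟨.ea, i, 0⟩
  | [.f _ _, .b i _] => ⟨.fb, i, 0⟩
  | [.a i _, .e j _] =>
    if i ≤ j then if j + 1 < n then ⟨.ae, i, j⟩ else ⟨.ae_last, i, 0⟩ else ⟨.ae_pred, i, 0⟩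
  | [.b i _, .f j _] =>
    if j ≤ i + 1 then if 3 ≤ j then ⟨.bf, j - 1, i⟩ else ⟨.bf_first, i, 0⟩ else ⟨.bf_succ, i, 0⟩
  | [.a i _, .f j _] => if j < n then ⟨.af, i, j - 1⟩ else ⟨.af_zero, i, 0⟩
  | [.b i _, .e j _] => if 2 ≤ j then ⟨.be, j, i⟩ else ⟨.be_zero, i, 0⟩
  -- Only the three-letter left sides `a_1 f_n e_1` and `b_{n-1} f_n e_1` remain.
  | .a _ _ :: _ => ⟨.a_zero, 0, 0⟩
  | _ => ⟨.b_zero, 0, 0⟩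

/-- This left inverse makes the parametrization injective, both within a family and across families,
so cardinalities of index sets can be added. -/
theorem decode_rel (hn : 2 ≤ n) (k : Family) {i j : ℕ} (h : (i, j) ∈ k.index n) :
    decode n (k.rel n i j).1.toList = ⟨k, i, j⟩ := by
  cases k <;> simp only [Family.index, mem_triangle, mem_column] at h <;>
  simp (disch := omega) only [Family.rel, wordA_eq, wordB_eq, wordE_eq, wordF_eq] <;>
  simp only [wa, wb, we, wf, FreeMonoid.toList_mul, FreeMonoid.toList_of, List.cons_append,
    List.nil_append, decode] <;>
  (try split_ifs) <;> (try omega) <;> grind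

theorem rel_mem (hn : 2 ≤ n) (k : Family) {i j : ℕ} (h : (i, j) ∈ k.index n) :
    k.rel n i j ∈ PIORelations n := by
  cases k <;> simp only [Family.index, mem_triangle, mem_column] at h <;>
  simp (disch := omega) only [Family.rel, wordA_eq, wordB_eq, wordE_eq, wordF_eq]
  · exact PIORel.aa i j (by omega) (by omega) (by omega)
  · exact PIORel.aa_last i (by omega) (by omega)
  · exact PIORel.bb j i (by omega) (by omega) (by omega)
  · exact PIORel.bb_first i (by omega) (by omega)
  · exact PIORel.ab i j (by omega) (by omega) (by omega)
  · exact PIORel.ab_last i (by omega) (by omega)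
  · exact PIORel.ba_first i (by omega) (by omega)
  · exact PIORel.ee i j (by omega) (by omega) (by omega)
  · exact PIORel.ee_succ i (by omega) (by omega)
  · exact PIORel.ff i j (by omega) (by omega) (by omega)
  · exact PIORel.ff_succ i (by omega) (by omega)
  · exact PIORel.fe j (i + 1) (by omega) (by omega) (by omega)
  · exact PIORel.ef_zero i (by omega) (by omega)
  · exact PIORel.ea i (by omega) (by omega)
  · exact PIORel.fb i (by omega) (by omega)
  · exact PIORel.ae i j (by omega) (by omega) (by omega)
  · exact PIORel.ae_last i (by omega) (by omega)
  · exact PIORel.ae_pred i (by omega) (by omega)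
  · exact PIORel.bf j (i + 1) (by omega) (by omega) (by omega)
  · exact PIORel.bf_first i (by omega) (by omega)
  · exact PIORel.bf_succ i (by omega) (by omega)
  · exact PIORel.af i (j + 1) (by omega) (by omega) (by omega)
  · exact PIORel.af_zero i (by omega) (by omega)
  · exact PIORel.be j i (by omega) (by omega) (by omega)
  · exact PIORel.be_zero i (by omega) (by omega)
  · exact PIORel.a_zero hn
  · exact PIORel.b_zero hn

theorem exists_rel_eq (hn : 2 ≤ n) {u v : FreeMonoid (PIOLetter n)} (h : PIORel n u v) :
    ∃ k : Family, ∃ i j, (i, j) ∈ k.index n ∧ k.rel n i j = (u, v) := by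
  have key : ∀ k : Family, ∀ i j, (i, j) ∈ k.index n → k.rel n i j = (u, v) →
      ∃ k : Family, ∃ i j, (i, j) ∈ k.index n ∧ k.rel n i j = (u, v) :=
    fun k i j h h' => ⟨k, i, j, h, h'⟩
  cases h
  case' aa i j _ _ _ => refine key .aa i j ?_ ?_
  case' aa_last i _ _ => refine key .aa_last i 0 ?_ ?_
  case' bb i j _ _ _ => refine key .bb j i ?_ ?_
  case' bb_first i _ _ => refine key .bb_first i 0 ?_ ?_
  case' ab i j _ _ _ => refine key .ab i j ?_ ?_
  case' ab_last i _ _ => refine key .ab_last i 0 ?_ ?_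
  case' ba_first i _ _ => refine key .ba_first i 0 ?_ ?_
  case' ee i j _ _ _ => refine key .ee i j ?_ ?_
  case' ee_succ i _ _ => refine key .ee_succ i 0 ?_ ?_
  case' ff i j _ _ _ => refine key .ff i j ?_ ?_
  case' ff_succ i _ _ => refine key .ff_succ i 0 ?_ ?_
  case' fe i j _ _ _ =>
    obtain ⟨j, rfl⟩ : ∃ l, j = l + 1 := ⟨j - 1, by omega⟩
    refine key .fe j i ?_ ?_
  case' ef_zero i _ _ => refine key .ef_zero i 0 ?_ ?_
  case' ea i _ _ => refine key .ea i 0 ?_ ?_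
  case' fb i _ _ => refine key .fb i 0 ?_ ?_
  case' ae i j _ _ _ => refine key .ae i j ?_ ?_
  case' ae_last i _ _ => refine key .ae_last i 0 ?_ ?_
  case' ae_pred i _ _ => refine key .ae_pred i 0 ?_ ?_
  case' bf i j _ _ _ =>
    obtain ⟨j, rfl⟩ : ∃ l, j = l + 1 := ⟨j - 1, by omega⟩
    refine key .bf j i ?_ ?_
  case' bf_first i _ _ => refine key .bf_first i 0 ?_ ?_
  case' bf_succ i _ _ => refine key .bf_succ i 0 ?_ ?_
  case' af i j _ _ _ =>
    obtain ⟨j, rfl⟩ : ∃ l, j = l + 1 := ⟨j - 1, by omega⟩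
    refine key .af i j ?_ ?_
  case' af_zero i _ _ => refine key .af_zero i 0 ?_ ?_
  case' be i j _ _ _ => refine key .be j i ?_ ?_
  case' be_zero i _ _ => refine key .be_zero i 0 ?_ ?_
  case' a_zero => refine key .a_zero 0 0 ?_ ?_
  case' b_zero => refine key .b_zero 0 0 ?_ ?_
  all_goals first
    | (simp only [Family.index, mem_triangle, mem_column, and_true]; omega)
    | simp (disch := omega) only [Family.rel, wordA_eq, wordB_eq, wordE_eq, wordF_eq]

theorem sum_all (g : Family → ℕ) : ∑ k ∈ Family.all, g k =
    g .aa + (g .aa_last + (g .bb + (g .bb_first + (g .ab + (g .ab_last + (g .ba_first +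
    (g .ee + (g .ee_succ + (g .ff + (g .ff_succ + (g .fe + (g .ef_zero + (g .ea + (g .fb +
    (g .ae + (g .ae_last + (g .ae_pred + (g .bf + (g .bf_first + (g .bf_succ + (g .af +
    (g .af_zero + (g .be + (g .be_zero + (g .a_zero + g .b_zero))))))))))))))))))))))))) := by
  rfl

/-- There are seven triangles of side `n - 2`, three of side `n - 1`, eleven columns of length `n -
1`, four of length `n - 2`, and two single relations. -/
theorem sum_card_index (hn : 2 ≤ n) :
    ∑ k ∈ Family.all, (k.index n).card = 5 * n ^ 2 + 3 * n - 10 := by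
  obtain ⟨m, rfl⟩ : ∃ m, n = m + 2 := ⟨n - 2, by omega⟩
  have h₁ := two_mul_card_triangle 1 m
  have h₂ := two_mul_card_triangle 2 m
  have h₃ := two_mul_card_triangle 1 (m + 1)
  have h₄ := two_mul_card_triangle 2 (m + 1)
  rw [sum_all]
  simp only [Family.index, card_column, Nat.add_sub_cancel, show m + 2 - 1 = m + 1 from rfl]
  generalize (triangle 1 m).card = t₁ at *
  generalize (triangle 2 m).card = t₂ at *
  generalize (triangle 1 (m + 1)).card = t₃ at *
  generalize (triangle 2 (m + 1)).card = t₄ at *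
  rw [Nat.sub_eq_of_eq_add]
  ring_nf at h₁ h₂ h₃ h₄ ⊢
  linarith

end PIORel

theorem ncard_PIORelations {n : ℕ} (hn : 2 ≤ n) :
    (PIORelations n).ncard = 5 * n ^ 2 + 3 * n - 10 := by
  classical
  have himage : PIORelations n = (fun s : Σ _ : PIORel.Family, ℕ × ℕ => s.1.rel n s.2.1 s.2.2) ''
      (PIORel.Family.all.sigma fun k => k.index n : Finset _) := by
    ext ⟨u, v⟩
    constructor
    · intro h
      obtain ⟨k, i, j, hij, hrel⟩ := PIORel.exists_rel_eq hn h
      exact ⟨⟨k, i, j⟩, Finset.mem_coe.2 (Finset.mem_sigma.2 ⟨k.mem_all, hij⟩), hrel⟩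
    · rintro ⟨⟨k, i, j⟩, hs, hrel⟩
      rw [← hrel]
      exact PIORel.rel_mem hn k (Finset.mem_sigma.1 (Finset.mem_coe.1 hs)).2
  rw [himage, Set.InjOn.ncard_image, Set.ncard_coe_finset, Finset.card_sigma,
    PIORel.sum_card_index hn]
  · rintro ⟨k, i, j⟩ hs ⟨k', i', j'⟩ hs' h
    have h₁ := PIORel.decode_rel hn k (Finset.mem_sigma.1 (Finset.mem_coe.1 hs)).2
    have h₂ := PIORel.decode_rel hn k' (Finset.mem_sigma.1 (Finset.mem_coe.1 hs')).2
    rw [← h₁, ← h₂]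
    exact congrArg (fun p => PIORel.decode n p.1.toList) h

theorem ncard_RHat_PIORelations {n : ℕ} (hn : 2 ≤ n) :
    (RHat n (PIORelations n)).ncard = 5 * n ^ 2 + 5 * n - 10 := by
  have hcard := ncard_PIORelations hn
  -- This keeps the truncated subtraction of `10` exact and makes the count nonzero, from which
  -- finiteness follows.
  have hsq : 2 * n ≤ n ^ 2 := by nlinarith
  have hfin : (PIORelations n).Finite := Set.finite_of_ncard_ne_zero (by omega)
  rw [Set.ncard, encard_RHat hn, ← hfin.cast_ncard_eq, hcard,
    show ((5 * n ^ 2 + 3 * n - 10 : ℕ) : ℕ∞) + 2 * n =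
      ((5 * n ^ 2 + 3 * n - 10 + 2 * n : ℕ) : ℕ∞) by
      push_cast; rfl, ENat.toNat_natCast]
  omega

theorem theorem9 (n : ℕ) (hn : 2 ≤ n) :
    -- the alphabet has `4n - 3` letters, which denote pairwise distinct transformations
    Nat.card (PIMLetter n) = 4 * n - 3 ∧
    Function.Injective (PIMLetter.toPT (n := n)) ∧
    -- every presentation of `PIOn n` on the letters `a_i, b_i, e_i, f_j` extends to one of `PIMn n`
    (∀ R' : Relations (PIOLetter n), DefinedBy (PIOn n) PIOLetter.toPT R' →
      DefinedBy (PIMn n) PIMLetter.toPT (RHat n R') ∧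
      (RHat n R').encard = R'.encard + 2 * n) ∧
    -- the explicit presentation of `PIOn n`, and the resulting presentation of `PIMn n`
    DefinedBy (PIOn n) PIOLetter.toPT (PIORelations n) ∧
    (PIORelations n).ncard = 5 * n ^ 2 + 3 * n - 10 ∧
    DefinedBy (PIMn n) PIMLetter.toPT (RHat n (PIORelations n)) ∧
    (RHat n (PIORelations n)).ncard = 5 * n ^ 2 + 5 * n - 10 := by
  exact ⟨PIMLetter.nat_card hn, PIMLetter.toPT_injective hn,
    fun R' hR => ⟨definedBy_RHat hn hR, encard_RHat hn R'⟩, definedBy_PIORelations hn,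
    ncard_PIORelations hn, definedBy_RHat hn (definedBy_PIORelations hn),
    ncard_RHat_PIORelations hn⟩
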